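/- Let $\mathbb T^2=\mathbb R^2/\mathbb Z^2$ with its normalized Lebesgue measure, and write $\widehat f(\alpha)=\int_{\mathbb T^2}e^{-2\pi i\alpha\cdot x}f(x)\,dx$ for $f\in L^1(\mathbb T^2)$ and $\alpha\in\mathbb Z^2$. Let $\chi\in C_c^\infty(\mathbb R^2)$ be nonnegative and radial, supported in the unit ball, with $\chi(\xi)=1$ for $|\xi|\le 1/2$. Put $\lambda_q=2^q$, $\varphi(\xi)=\chi(\xi/2)-\chi(\xi)$, and for integers $q\ge 0$ \[ \Delta_q f=\sum_{\alpha\in\mathbb Z^2}\varphi(\lambda_q^{-1}\alpha)\widehat f(\alpha)e^{2\pi i\alpha\cdot x},\qquad S_q[f]=\sum_{\alpha\in\mathbb Z^2}\chi(\lambda_q^{-1}\alpha)\widehat f(\alpha)e^{2\pi i\alpha\cdot x} \] (acting componentwise on vector fields). An integrable $u$ belongs to $B^{1/3}_{3,\infty}(\mathbb T^2)$ if $\sup_{q\ge0}\lambda_q^{1/3}\|\Delta_q u\|_{L^3(\mathbb T^2)}<\infty$. Then there exists a real vector field $u:\mathbb T^2\to\mathbb R^2$, divergence-free in the sense of distributions,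 such that $u\in B^{1/3}_{3,\infty}(\mathbb T^2)$ and $u\in W^{1,p}(\mathbb T^2)$ for every $1\le p<3/2$ (the same $u$ for all $p$), so that in particular $(u\cdot\nabla)u$, formed with the weak gradient of $u$, is integrable, and such that the energy flux \[ \Pi_q[u]=\int_{\mathbb T^2}S_q[u]\cdot S_q[(u\cdot\nabla)u]\,dx \] satisfies $\limsup_{q\to\infty}\Pi_q[u]\neq 0$. -/

import Mathlib

open MeasureTheory Filter
open scoped ENNReal NNReal ContDiff

noncomputable section

/-- The torus `𝕋² = ℝ² / ℤ²`. -/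
abbrev Torus2 : Type := UnitAddTorus (Fin 2)

/-- The Lebesgue measure of the torus, which has total mass `1`. It is the measure with respect to
which `UnitAddTorus.mFourierCoeff` integrates. -/
abbrev torusMeasure : Measure Torus2 := Measure.pi fun _ => AddCircle.haarAddCircle

/-- Vectors of the Euclidean plane. -/
abbrev Plane : Type := EuclideanSpace ℝ (Fin 2)

/-! ### Littlewood–Paley theory -/

/-- The admissible cut-off functions: `χ ∈ C_c^∞(ℝ²)` is nonnegative and radial, is supported in
the unit ball, and equals `1` where `|ξ| ≤ 1/2`. -/
structure IsCutoff (χ : Plane → ℝ) : Prop where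
  smooth : ContDiff ℝ ∞ χ
  nonneg : ∀ ξ, 0 ≤ χ ξ
  radial : ∀ ξ η : Plane, ‖ξ‖ = ‖η‖ → χ ξ = χ η
  support_subset : tsupport χ ⊆ Metric.closedBall 0 1
  eq_one : ∀ ξ : Plane, ‖ξ‖ ≤ 1 / 2 → χ ξ = 1

/-- The frequency `α ∈ ℤ²` as a vector of the plane. -/
def freq (α : Fin 2 → ℤ) : Plane := WithLp.toLp 2 fun i => (α i : ℝ)

/-- The Fourier multiplier `f ↦ ∑_α m(λ_q⁻¹ α) f̂(α) e^{2πi α·x}`, where `λ_q = 2^q`. For `m` of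
compact support only finitely many terms are nonzero. -/
def dyadicMultiplier (m : Plane → ℝ) (q : ℕ) (f : Torus2 → ℝ) (x : Torus2) : ℂ :=
  ∑' α : Fin 2 → ℤ, (m (((2 : ℝ) ^ q)⁻¹ • freq α) : ℂ) *
    UnitAddTorus.mFourierCoeff (fun y => (f y : ℂ)) α * UnitAddTorus.mFourier α x

/-- The profile `φ(ξ) = χ(ξ/2) - χ(ξ)` of the dyadic shells. -/
def shell (χ : Plane → ℝ) (ξ : Plane) : ℝ := χ ((2 : ℝ)⁻¹ • ξ) - χ ξ

/-- The Littlewood–Paley component `Δ_q f`. -/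
def lpComponent (χ : Plane → ℝ) (q : ℕ) (f : Torus2 → ℝ) : Torus2 → ℂ :=
  dyadicMultiplier (shell χ) q f

/-- The Littlewood–Paley truncation `S_q[f]`. -/
def lpTruncation (χ : Plane → ℝ) (q : ℕ) (f : Torus2 → ℝ) : Torus2 → ℂ :=
  dyadicMultiplier χ q f

/-- `u ∈ B^s_{p,∞}(𝕋²)` for `s > 0`: `u` is integrable and `sup_{q ≥ 0} λ_q^s ‖Δ_q u‖_{L^p} < ∞`,
componentwise. The components `Δ_q` with `q < 0` vanish on the torus, and the only remaining
frequency, the mean `û(0)`, is finite. -/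
def MemBesovTop (χ : Plane → ℝ) (s : ℝ) (p : ℝ≥0∞) (u : Torus2 → Plane) : Prop :=
  ∀ i, Integrable (fun x => u x i) torusMeasure ∧
    ∃ C : ℝ≥0, ∀ q : ℕ,
      ENNReal.ofReal (((2 : ℝ) ^ q) ^ s) * eLpNorm (lpComponent χ q fun x => u x i) p torusMeasure ≤ C

/-! ### Weak derivatives on the torus -/

/-- Smooth real functions on the torus: the periodic lift to `ℝ²` is `C^∞`. -/
def IsTestFunction (φ : Torus2 → ℝ) : Prop :=
  ContDiff ℝ ∞ fun y : Fin 2 → ℝ => φ fun i => (y i : UnitAddCircle)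

/-- The classical partial derivative `∂_j φ` of a function on the torus. -/
def torusPartial (j : Fin 2) (φ : Torus2 → ℝ) (x : Torus2) : ℝ :=
  deriv (fun t : ℝ => φ (x + Pi.single j (t : UnitAddCircle))) 0

/-- `G` is the weak gradient of the vector field `u`, with `G x i j = ∂_j u_i (x)`. -/
def HasWeakGradient (u : Torus2 → Plane) (G : Torus2 → Matrix (Fin 2) (Fin 2) ℝ) : Prop :=
  (∀ i, Integrable (fun x => u x i) torusMeasure) ∧
    (∀ i j, Integrable (fun x => G x i j) torusMeasure) ∧
    ∀ i j, ∀ φ : Torus2 → ℝ, IsTestFunction φ →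
      ∫ x, u x i * torusPartial j φ x ∂torusMeasure = -∫ x, G x i j * φ x ∂torusMeasure

/-- `u ∈ W^{1,p}(𝕋²)`: `u` and its weak gradient are in `L^p`. -/
def MemSobolevOne (p : ℝ≥0∞) (u : Torus2 → Plane) : Prop :=
  (∀ i, MemLp (fun x => u x i) p torusMeasure) ∧
    ∃ G, HasWeakGradient u G ∧ ∀ i j, MemLp (fun x => G x i j) p torusMeasure

/-- `div u = 0` in the sense of distributions. -/
def IsDivergenceFree (u : Torus2 → Plane) : Prop :=
  (∀ i, Integrable (fun x => u x i) torusMeasure) ∧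
    ∀ φ : Torus2 → ℝ, IsTestFunction φ → ∫ x, ∑ j, u x j * torusPartial j φ x ∂torusMeasure = 0

/-! ### The energy flux -/

/-- The `i`-th component `∑_j u_j ∂_j u_i` of `(u · ∇) u`, where `G` is the weak gradient of `u`. -/
def advection (u : Torus2 → Plane) (G : Torus2 → Matrix (Fin 2) (Fin 2) ℝ) (i : Fin 2)
    (x : Torus2) : ℝ :=
  ∑ j, u x j * G x i j

/-- The energy flux `Π_q[u] = ∫ S_q[u] · S_q[(u · ∇) u] dx`, where `G` is the weak gradient of `u`.
For an even `χ` the truncations of real functions are real, so the integral is real; `re` only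
changes its type. -/
def energyFlux (χ : Plane → ℝ) (q : ℕ) (u : Torus2 → Plane)
    (G : Torus2 → Matrix (Fin 2) (Fin 2) ℝ) : ℝ :=
  (∫ x, ∑ i, lpTruncation χ q (fun y => u y i) x * lpTruncation χ q (advection u G i) x
    ∂torusMeasure).re

end

/-!
The flow is a lacunary superposition of intermittent blocks. The frequencies of a block with lattice
spacing `M` and cluster scale `s` are the points of `M ℤ²` in six squares of side comparable to
`M s`, centred at a triad `z₁ + z₂ + z₃ = 0` and its reflection. Sparsity makes a block concentrate
on a set of measure about `s⁻²`: its velocity is a sum of products of two Dirichlet kernels, so that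
its `L¹` and `L^∞` norms are comparable to those of a multiple of an indicator function of such a
set. If `s` is much larger than `M`, this keeps the gradient in `L^p` for `p < 3/2`, although the
velocity has the critical size `(M s)^(-1/3)` in `L³`.

The energy fluxes through all triads of a block add up with the same sign when the truncation
separates the shortest pair of clusters from the other four. The truncation at `2^q = 64 M s` does
this, and the amplitude is chosen so that the resulting flux is at least `π / 16` for every block.
Earlier blocks pass through the truncation unchanged and have no flux by antisymmetry, later blocks
are removed, and frequencies of different blocks never form a triad.
-/

noncomputable section

namespace IntermittentFlow

open UnitAddTorus ComplexConjugate Topology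

/-! ### Integrals and series of functions -/

section Integration

variable {X E : Type*} [MeasurableSpace X] {μ : Measure X} [NormedAddCommGroup E]

theorem integrable_of_continuous [TopologicalSpace X] [CompactSpace X] [T2Space X]
    [OpensMeasurableSpace X] [IsFiniteMeasureOnCompacts μ] {f : X → E} (hf : Continuous f) :
    Integrable f μ :=
  hf.integrable_of_hasCompactSupport (HasCompactSupport.of_compactSpace f)

theorem integral_norm_mul_norm_le {f g : X → E} (hf : MemLp f 2 μ) (hg : MemLp g 2 μ) {a b : ℝ}
    (ha : 0 ≤ a) (hb : 0 ≤ b) (hfa : ∫ x, ‖f x‖ ^ 2 ∂μ ≤ a ^ 2)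
    (hgb : ∫ x, ‖g x‖ ^ 2 ∂μ ≤ b ^ 2) : ∫ x, ‖f x‖ * ‖g x‖ ∂μ ≤ a * b := by
  have two : ENNReal.ofReal 2 = 2 := by norm_num
  refine (integral_mul_le_Lp_mul_Lq_of_nonneg Real.HolderConjugate.two_two
    (ae_of_all _ fun x => norm_nonneg (f x)) (ae_of_all _ fun x => norm_nonneg (g x))
    (two ▸ hf.norm) (two ▸ hg.norm)).trans ?_
  simp only [Real.rpow_two, ← Real.sqrt_eq_rpow]
  exact mul_le_mul (Real.sqrt_le_iff.2 ⟨ha, hfa⟩) (Real.sqrt_le_iff.2 ⟨hb, hgb⟩)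
    (Real.sqrt_nonneg _) ha

theorem integral_norm_mul_le_of_norm_le {R : Type*} [NormedRing R] {f g : X → R} {B : ℝ}
    (hfB : ∀ x, ‖f x‖ ≤ B) (hg : Integrable g μ) :
    ∫ x, ‖f x * g x‖ ∂μ ≤ B * ∫ x, ‖g x‖ ∂μ := by
  rw [← integral_const_mul]
  exact integral_mono_of_nonneg (ae_of_all _ fun x => norm_nonneg _) (hg.norm.const_mul B)
    (ae_of_all _ fun x => (norm_mul_le _ _).trans
      (mul_le_mul_of_nonneg_right (hfB x) (norm_nonneg _)))

-- Interpolation: `f` behaves like `B` times the indicator of a set of measure `θ`.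
theorem eLpNorm_le_of_norm_le_of_integral_rpow_le {f : X → E} {p r B θ : ℝ} (hr : 0 < r)
    (hrp : r ≤ p) (hB : 0 ≤ B) (hθ : 0 ≤ θ) (hfB : ∀ x, ‖f x‖ ≤ B)
    (hf : Integrable (fun x => ‖f x‖ ^ r) μ) (hfθ : ∫ x, ‖f x‖ ^ r ∂μ ≤ B ^ r * θ) :
    eLpNorm f (ENNReal.ofReal p) μ ≤ ENNReal.ofReal (B * θ ^ (1 / p)) := by
  have hp : 0 < p := hr.trans_le hrp
  have rpow_le : ∀ x, ‖f x‖ ^ p ≤ B ^ (p - r) * ‖f x‖ ^ r := fun x => by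
    rw [← sub_add_cancel p r, Real.rpow_add_of_nonneg (norm_nonneg _) (sub_nonneg.2 hrp) hr.le,
      sub_add_cancel]
    exact mul_le_mul_of_nonneg_right
      (Real.rpow_le_rpow (norm_nonneg _) (hfB x) (sub_nonneg.2 hrp)) (by positivity)
  have rpow_bound : B ^ (p - r) * (B ^ r * θ) = B ^ p * θ := by
    rw [← mul_assoc, ← Real.rpow_add_of_nonneg hB (sub_nonneg.2 hrp) hr.le, sub_add_cancel]
  have root_bound : B * θ ^ (1 / p) = (B ^ p * θ) ^ (1 / p) := by
    rw [Real.mul_rpow (Real.rpow_nonneg hB p) hθ, ← Real.rpow_mul hB, mul_one_div_cancel hp.ne',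
      Real.rpow_one]
  rw [eLpNorm_eq_lintegral_rpow_enorm_toReal (by simpa using hp) ENNReal.ofReal_ne_top,
    ENNReal.toReal_ofReal hp.le, root_bound,
    ← ENNReal.ofReal_rpow_of_nonneg (mul_nonneg (Real.rpow_nonneg hB p) hθ) (by positivity)]
  gcongr
  calc ∫⁻ x, ‖f x‖ₑ ^ p ∂μ ≤ ∫⁻ x, ENNReal.ofReal (B ^ (p - r) * ‖f x‖ ^ r) ∂μ :=
        lintegral_mono fun x => by
          rw [← ofReal_norm, ENNReal.ofReal_rpow_of_nonneg (norm_nonneg _) hp.le]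
          exact ENNReal.ofReal_le_ofReal (rpow_le x)
    _ = ENNReal.ofReal (B ^ (p - r) * ∫ x, ‖f x‖ ^ r ∂μ) := by
        rw [← integral_const_mul, ofReal_integral_eq_lintegral_ofReal (hf.const_mul _)
          (ae_of_all _ fun x => by positivity)]
    _ ≤ ENNReal.ofReal (B ^ p * θ) := by
        rw [← rpow_bound]
        gcongr

theorem tsum_eLpNorm_one_ne_top {ι : Type*} {f : ι → X → E} (hf : ∀ i, Integrable (f i) μ)
    (hs : Summable fun i => ∫ x, ‖f i x‖ ∂μ) : ∑' i, eLpNorm (f i) 1 μ ≠ ⊤ := by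
  simp_rw [eLpNorm_one_eq_lintegral_enorm, ← ofReal_integral_norm_eq_lintegral_enorm (hf _)]
  exact hs.tsum_ofReal_ne_top

variable {ι κ : Type*} [Countable ι] [Countable κ]

theorem memLp_tsum [CompleteSpace E] {f : ι → X → E} {p : ℝ≥0∞} (hp : 1 ≤ p)
    (hf : ∀ i, AEStronglyMeasurable (f i) μ) (hs : ∑' i, eLpNorm (f i) p μ ≠ ⊤) :
    MemLp (fun x => ∑' i, f i x) p μ := by
  have : Fact (1 ≤ p) := ⟨hp⟩
  have hLp : ∀ i, MemLp (f i) p μ := fun i => ⟨hf i, (ENNReal.le_tsum i).trans_lt hs.lt_top⟩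
  have hsum := Lp.coeFn_tsum (f := fun i => (hLp i).toLp (f i)) (by simpa [Lp.enorm_toLp] using hs)
  refine (Lp.memLp (∑' i, (hLp i).toLp (f i))).ae_eq ?_
  filter_upwards [hsum, ae_all_iff.2 fun i => (hLp i).coeFn_toLp] with x hx hfx
  simp only [hx, hfx]

theorem ae_summable_norm {f : ι → X → E} (hf : ∀ i, Integrable (f i) μ)
    (hs : Summable fun i => ∫ x, ‖f i x‖ ∂μ) : ∀ᵐ x ∂μ, Summable fun i => ‖f i x‖ :=
  summable_norm_of_tsum_eLpNorm_ne_top le_rfl (fun i => (hf i).1) (tsum_eLpNorm_one_ne_top hf hs)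

theorem integrable_tsum [CompleteSpace E] {f : ι → X → E} (hf : ∀ i, Integrable (f i) μ)
    (hs : Summable fun i => ∫ x, ‖f i x‖ ∂μ) : Integrable (fun x => ∑' i, f i x) μ :=
  memLp_one_iff_integrable.1
    (memLp_tsum le_rfl (fun i => (hf i).1) (tsum_eLpNorm_one_ne_top hf hs))

theorem hasSum_integral_smul_of_bounded {𝕜 : Type*} [RCLike 𝕜] [NormedSpace 𝕜 E]
    [NormedSpace ℝ E] {f : ι → X → 𝕜} {w : X → E} (hf : ∀ i, Integrable (f i) μ)
    (hs : Summable fun i => ∫ x, ‖f i x‖ ∂μ) (hw : AEStronglyMeasurable w μ) {C : ℝ}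
    (hC : ∀ x, ‖w x‖ ≤ C) :
    HasSum (fun i => ∫ x, f i x • w x ∂μ) (∫ x, (∑' i, f i x) • w x ∂μ) := by
  have hint : ∀ i, Integrable (fun x => f i x • w x) μ := fun i =>
    (hf i).smul_bdd C hw (ae_of_all _ hC)
  have hsum : Summable fun i => ∫ x, ‖f i x • w x‖ ∂μ := by
    refine (hs.mul_right C).of_nonneg_of_le (fun i => integral_nonneg fun _ => norm_nonneg _)
      fun i => ?_
    rw [← integral_mul_const]
    refine integral_mono (hint i).norm ((hf i).norm.mul_const C) fun x => ?_
    rw [norm_smul]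
    exact mul_le_mul_of_nonneg_left (hC x) (norm_nonneg _)
  have hae : ∀ᵐ x ∂μ, ∑' i, f i x • w x = (∑' i, f i x) • w x := by
    filter_upwards [ae_summable_norm hf hs] with x hx using hx.of_norm.tsum_smul_const (w x)
  exact integral_congr_ae hae ▸ hasSum_integral_of_summable_integral_norm hint hsum

theorem ae_tsum_mul_tsum {R : Type*} [NormedRing R] [CompleteSpace R] {f : ι → X → R}
    {g : κ → X → R} (hf : ∀ i, Integrable (f i) μ) (hfs : Summable fun i => ∫ x, ‖f i x‖ ∂μ)
    (hg : ∀ i, Integrable (g i) μ) (hgs : Summable fun i => ∫ x, ‖g i x‖ ∂μ) :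
    ∀ᵐ x ∂μ, (∑' i, f i x) * ∑' i, g i x = ∑' i : ι × κ, f i.1 x * g i.2 x := by
  filter_upwards [ae_summable_norm hf hfs, ae_summable_norm hg hgs] with x hfx hgx
  exact tsum_mul_tsum_of_summable_norm hfx hgx

end Integration

/-! ### Trigonometric polynomials -/

section TrigonometricPolynomials

variable {d : Type*} [Fintype d]

/-- The Haar probability measure of the torus of any dimension, in the form in which
`torusMeasure` is given. -/
abbrev torusHaar (d : Type*) [Fintype d] : Measure (UnitAddTorus d) :=
  Measure.pi fun _ => AddCircle.haarAddCircle

theorem integral_mFourier (α : d → ℤ) [Decidable (α = 0)] :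
    ∫ x, mFourier α x ∂torusHaar d = if α = 0 then 1 else 0 := by
  have h := orthonormal_iff_ite.mp (orthonormal_mFourier (d := d)) 0 α
  simp only [ContinuousMap.inner_toLp, mFourier_zero] at h
  calc ∫ x, mFourier α x ∂torusHaar d = if (0 : d → ℤ) = α then 1 else 0 := by
        rw [← h]
        exact integral_congr_ae (ae_of_all _ fun x => by simp)
    _ = _ := by simp [eq_comm]

theorem norm_mFourier_apply (α : d → ℤ) (x : UnitAddTorus d) : ‖mFourier α x‖ = 1 := by
  simp only [mFourier, fourier_apply, ContinuousMap.coe_mk, norm_prod, Circle.norm_coe,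
    Finset.prod_const_one]

theorem mFourier_add_single [DecidableEq d] (α : d → ℤ) (x : UnitAddTorus d) (j : d)
    (t : UnitAddCircle) :
    mFourier α (x + Pi.single j t) = fourier (α j) t * mFourier α x := by
  have factor : ∀ i, fourier (α i) ((x + Pi.single j t : UnitAddTorus d) i) =
      (if i = j then fourier (α j) t else 1) * fourier (α i) (x i) := by
    intro i
    by_cases h : i = j
    · subst h
      simp [fourier_apply, smul_add, AddCircle.toCircle_add, mul_comm]
    · simp [h]
  simp only [mFourier, ContinuousMap.coe_mk, factor, Finset.prod_mul_distrib]
  simp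

/-- The trigonometric polynomial with frequencies in `s` and coefficients `c`. -/
def trigPoly (s : Finset (d → ℤ)) (c : (d → ℤ) → ℂ) (x : UnitAddTorus d) : ℂ :=
  ∑ α ∈ s, c α * mFourier α x

variable (s : Finset (d → ℤ)) (c : (d → ℤ) → ℂ)

@[fun_prop]
theorem continuous_trigPoly : Continuous (trigPoly s c) := by
  unfold trigPoly; fun_prop

theorem norm_trigPoly_le (x : UnitAddTorus d) : ‖trigPoly s c x‖ ≤ ∑ α ∈ s, ‖c α‖ :=
  norm_sum_le_of_le _ fun α _ => by rw [norm_mul, norm_mFourier_apply, mul_one]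

theorem integral_mFourier_mul_trigPoly (β : d → ℤ) [Decidable (-β ∈ s)] :
    ∫ x, mFourier β x * trigPoly s c x ∂torusHaar d = if -β ∈ s then c (-β) else 0 := by
  classical
  have expand : ∀ x, mFourier β x * trigPoly s c x = ∑ α ∈ s, c α * mFourier (β + α) x := by
    intro x
    rw [trigPoly, Finset.mul_sum]
    exact Finset.sum_congr rfl fun α _ => by rw [mFourier_add]; ring
  simp_rw [expand]
  rw [integral_finsetSum _ fun α _ => integrable_of_continuous (by fun_prop)]
  simp_rw [integral_const_mul, integral_mFourier, add_eq_zero_iff_neg_eq]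
  simp

theorem integral_trigPoly_mul_trigPoly_mul_trigPoly {s₁ : Finset (d → ℤ)} (s₂ s₃ : Finset (d → ℤ))
    {c₁ : (d → ℤ) → ℂ} (c₂ c₃ : (d → ℤ) → ℂ) (hc₁ : ∀ α ∉ s₁, c₁ α = 0) :
    ∫ x, trigPoly s₁ c₁ x * (trigPoly s₂ c₂ x * trigPoly s₃ c₃ x) ∂torusHaar d =
      ∑ β ∈ s₂, ∑ γ ∈ s₃, c₁ (-(β + γ)) * (c₂ β * c₃ γ) := by
  classical
  have expand : ∀ x, trigPoly s₁ c₁ x * (trigPoly s₂ c₂ x * trigPoly s₃ c₃ x) =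
      ∑ β ∈ s₂, ∑ γ ∈ s₃, c₂ β * c₃ γ * (mFourier (β + γ) x * trigPoly s₁ c₁ x) := by
    intro x
    rw [trigPoly.eq_def s₂, trigPoly.eq_def s₃, Finset.sum_mul_sum, Finset.mul_sum]
    refine Finset.sum_congr rfl fun β _ => ?_
    rw [Finset.mul_sum]
    exact Finset.sum_congr rfl fun γ _ => by rw [mFourier_add]; ring
  simp_rw [expand]
  rw [integral_finsetSum _ fun β _ => integrable_of_continuous (by fun_prop)]
  refine Finset.sum_congr rfl fun β _ => ?_
  rw [integral_finsetSum _ fun γ _ => integrable_of_continuous (by fun_prop)]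
  refine Finset.sum_congr rfl fun γ _ => ?_
  rw [integral_const_mul, integral_mFourier_mul_trigPoly, mul_comm]
  split_ifs with h
  · rfl
  · rw [hc₁ _ h]

theorem integral_norm_trigPoly_sq :
    ∫ x, ‖trigPoly s c x‖ ^ 2 ∂torusHaar d = ∑ α ∈ s, ‖c α‖ ^ 2 := by
  classical
  have expand : ∀ x, ((‖trigPoly s c x‖ ^ 2 : ℝ) : ℂ) =
      ∑ α ∈ s, conj (c α) * (mFourier (-α) x * trigPoly s c x) := by
    intro x
    push_cast
    rw [← Complex.conj_mul', trigPoly, map_sum, Finset.sum_mul]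
    exact Finset.sum_congr rfl fun α _ => by rw [map_mul, mFourier_neg, mul_assoc]
  apply Complex.ofReal_injective
  rw [← integral_complex_ofReal]
  simp_rw [expand]
  rw [integral_finsetSum _ fun α _ => integrable_of_continuous (by fun_prop)]
  simp_rw [integral_const_mul, integral_mFourier_mul_trigPoly]
  push_cast
  exact Finset.sum_congr rfl fun α hα => by rw [neg_neg, if_pos hα, Complex.conj_mul']

variable {s c}

theorem ofReal_re_trigPoly (hs : ∀ α ∈ s, -α ∈ s) (hc : ∀ α, c (-α) = conj (c α))
    (x : UnitAddTorus d) : (((trigPoly s c x).re : ℝ) : ℂ) = trigPoly s c x := by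
  rw [← Complex.conj_eq_iff_re, trigPoly, map_sum]
  refine Finset.sum_nbij' (fun α => -α) (fun α => -α) hs hs (by simp) (by simp) fun α _ => ?_
  rw [map_mul, ← mFourier_neg, hc]

end TrigonometricPolynomials

/-! ### Integration by parts on the torus -/

section IntegrationByParts

variable {d : Type*} [Fintype d] [DecidableEq d]

theorem hasDerivAt_mFourier (α : d → ℤ) (j : d) (x : UnitAddTorus d) (t : ℝ) :
    HasDerivAt (fun t : ℝ => mFourier α (x + Pi.single j (t : UnitAddCircle)))
      (2 * Real.pi * Complex.I * α j * mFourier α (x + Pi.single j (t : UnitAddCircle))) t := by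
  simp_rw [mFourier_add_single]
  refine ((hasDerivAt_fourier 1 (α j) t).mul_const (mFourier α x)).congr_deriv ?_
  push_cast
  ring

theorem integral_eq_zero_of_hasDerivAt {f f' : UnitAddTorus d → ℂ} (hf : Continuous f)
    (hf' : Continuous f') (j : d) (hder : ∀ (x : UnitAddTorus d) (t : ℝ), HasDerivAt
      (fun t : ℝ => f (x + Pi.single j (t : UnitAddCircle)))
      (f' (x + Pi.single j (t : UnitAddCircle))) t) :
    ∫ x, f' x ∂torusHaar d = 0 := by
  have hshift : ∀ t : ℝ, Continuous fun x : UnitAddTorus d => x + Pi.single j (t : UnitAddCircle) :=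
    fun t => continuous_id.add continuous_const
  obtain ⟨C, hC⟩ := isCompact_univ.exists_bound_of_continuousOn (f := f') hf'.continuousOn
  have hmeas : ∀ᶠ t : ℝ in 𝓝 0, AEStronglyMeasurable
      (fun x => f (x + Pi.single j (t : UnitAddCircle))) (torusHaar d) :=
    Eventually.of_forall fun t => (hf.comp (hshift t)).aestronglyMeasurable
  have hmeas' : AEStronglyMeasurable
      (fun x => f' (x + Pi.single j ((0 : ℝ) : UnitAddCircle))) (torusHaar d) :=
    (hf'.comp (hshift 0)).aestronglyMeasurable
  have deriv_shift := (hasDerivAt_integral_of_dominated_loc_of_deriv_le Filter.univ_mem hmeas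
    (integrable_of_continuous (hf.comp (hshift 0)))
    (F' := fun (t : ℝ) (x : UnitAddTorus d) => f' (x + Pi.single j (t : UnitAddCircle))) hmeas'
    (ae_of_all _ fun x t _ => hC _ (Set.mem_univ _)) (integrable_const C)
    (ae_of_all _ fun x t _ => hder x t)).2
  have integral_shift : (fun t : ℝ => ∫ x, f (x + Pi.single j (t : UnitAddCircle)) ∂torusHaar d) =
      fun _ => ∫ x, f x ∂torusHaar d :=
    funext fun t => integral_add_right_eq_self (μ := torusHaar d) f (Pi.single j t)
  rw [integral_shift] at deriv_shift
  rw [(hasDerivAt_const (0 : ℝ) (∫ x, f x ∂torusHaar d)).unique deriv_shift]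
  exact integral_congr_ae (ae_of_all _ fun x => by simp)

end IntegrationByParts

section TestFunctions

/-- The covering map of the torus by the plane, through which `IsTestFunction` is defined. -/
def torusMk (y : Fin 2 → ℝ) : Torus2 := fun i => (y i : UnitAddCircle)

theorem isOpenQuotientMap_torusMk : IsOpenQuotientMap torusMk :=
  IsOpenQuotientMap.piMap fun _ => QuotientAddGroup.isOpenQuotientMap_mk

theorem torusMk_add_single (y : Fin 2 → ℝ) (j : Fin 2) (t : ℝ) :
    torusMk (y + Pi.single j t) = torusMk y + Pi.single j (t : UnitAddCircle) := by
  funext i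
  by_cases h : i = j
  · subst h; simp [torusMk]
  · simp [torusMk, h]

variable {φ : Torus2 → ℝ} (hφ : IsTestFunction φ) (j : Fin 2)
include hφ

theorem hasDerivAt_lift (y : Fin 2 → ℝ) (t : ℝ) :
    HasDerivAt (fun t : ℝ => φ (torusMk y + Pi.single j (t : UnitAddCircle)))
      (fderiv ℝ (fun z => φ (torusMk z)) (y + Pi.single j t) (Pi.single j 1)) t := by
  have hd : DifferentiableAt ℝ (fun z => φ (torusMk z)) (y + Pi.single j t) :=
    (ContDiff.differentiable hφ (by simp)).differentiableAt
  have hl : HasDerivAt (fun t : ℝ => y + Pi.single j t) (Pi.single j (1 : ℝ)) t := by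
    simpa using (hasDerivAt_single j t).const_add y
  simpa only [Function.comp_def, torusMk_add_single] using! hd.hasFDerivAt.comp_hasDerivAt t hl

theorem torusPartial_torusMk (y : Fin 2 → ℝ) :
    torusPartial j φ (torusMk y) = fderiv ℝ (fun z => φ (torusMk z)) y (Pi.single j 1) := by
  simpa [torusPartial] using (hasDerivAt_lift hφ j y 0).deriv

theorem continuous_of_isTestFunction : Continuous φ :=
  isOpenQuotientMap_torusMk.isQuotientMap.continuous_iff.2 (ContDiff.continuous hφ)

theorem continuous_torusPartial : Continuous (torusPartial j φ) := by
  refine isOpenQuotientMap_torusMk.isQuotientMap.continuous_iff.2 ?_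
  rw [show torusPartial j φ ∘ torusMk = _ from funext (torusPartial_torusMk hφ j)]
  exact (ContDiff.continuous_fderiv hφ (by simp)).clm_apply continuous_const

theorem hasDerivAt_torusPartial (x : Torus2) (t : ℝ) :
    HasDerivAt (fun t : ℝ => φ (x + Pi.single j (t : UnitAddCircle)))
      (torusPartial j φ (x + Pi.single j (t : UnitAddCircle))) t := by
  obtain ⟨y, rfl⟩ := isOpenQuotientMap_torusMk.surjective x
  rw [← torusMk_add_single, torusPartial_torusMk hφ]
  exact hasDerivAt_lift hφ j y t

theorem integral_mFourier_mul_torusPartial (α : Fin 2 → ℤ) :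
    ∫ x, mFourier α x * (torusPartial j φ x : ℂ) ∂torusMeasure =
      -∫ x, (2 * Real.pi * Complex.I * α j * mFourier α x) * (φ x : ℂ) ∂torusMeasure := by
  have hc := continuous_of_isTestFunction hφ
  have hc' := continuous_torusPartial hφ j
  have h₁ : Continuous fun x => (2 * Real.pi * Complex.I * α j * mFourier α x) * (φ x : ℂ) := by
    fun_prop
  have h₂ : Continuous fun x => mFourier α x * (torusPartial j φ x : ℂ) := by fun_prop
  have parts := integral_eq_zero_of_hasDerivAt (f := fun x => mFourier α x * (φ x : ℂ))
    (by fun_prop) (h₁.add h₂) j fun x t =>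
      (hasDerivAt_mFourier α j x t).mul (hasDerivAt_torusPartial hφ j x t).ofReal_comp
  rw [integral_add' (integrable_of_continuous h₁) (integrable_of_continuous h₂)] at parts
  linear_combination parts

end TestFunctions

/-! ### Blocks of frequencies -/

/-- Frequencies of functions on the torus, the dual group `ℤ²`. -/
abbrev Freq : Type := Fin 2 → ℤ

/-- The centres of the clusters of a block: the triad `(3, 0) + (3, 9) + (-6, -9) = 0` and its
reflection, which makes the fields real. -/
def centers : Finset Freq := {![3, 0], ![-3, 0], ![3, 9], ![-3, -9], ![-6, -9], ![6, 9]}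

/-- The centres of least length, whose clusters survive the critical truncation. -/
def innerCenters : Finset Freq := {![3, 0], ![-3, 0]}

/-- The square of frequencies `[-s, s]²`. -/
def box (s : ℕ) : Finset Freq := Finset.Icc (fun _ => -(s : ℤ)) (fun _ => (s : ℤ))

/-- Index set of the frequencies of a block, with multiplicity: a centre and two offsets, which
`blockFreq` adds. On the Fourier side this convolves the indicator of a square with itself, so that
in physical space a block is a sum of squares of Dirichlet kernels, which are small in `L¹`. -/
def blockIndex (s : ℕ) : Finset (Freq × Freq × Freq) := centers ×ˢ box s ×ˢ box s

/-- The frequency at offset `β` from the centre `z`, for cluster scale `s` and lattice spacing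
`M`. -/
def node (M s : ℕ) (z β : Freq) : Freq := fun i => M * (8 * s * z i + β i)

/-- The frequency attached to an index. -/
def blockFreq (M s : ℕ) (t : Freq × Freq × Freq) : Freq := node M s t.1 (t.2.1 + t.2.2)

/-- The frequencies of a block; all of them have length comparable to `M * s`. -/
def block (M s : ℕ) : Finset Freq := (blockIndex s).image (blockFreq M s)

/-- The number of representations of a frequency in a block. -/
def multiplicity (M s : ℕ) (α : Freq) : ℕ :=
  ((blockIndex s).filter fun t => blockFreq M s t = α).card

section Box

variable {s t : ℕ} {β γ : Freq}

theorem mem_box : β ∈ box s ↔ ∀ i, |β i| ≤ s := by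
  simp only [box, Finset.mem_Icc, Pi.le_def, abs_le, forall_and]

theorem card_box (s : ℕ) : (box s).card = (2 * s + 1) ^ 2 := by
  rw [box, Pi.card_Icc]
  simp only [Int.card_Icc, Finset.prod_const, Finset.card_univ, Fintype.card_fin]
  congr 1
  omega

theorem zero_mem_box (s : ℕ) : 0 ∈ box s := by simp [mem_box]

theorem neg_mem_box (hβ : β ∈ box s) : -β ∈ box s := by
  simpa only [mem_box, Pi.neg_apply, abs_neg] using hβ

theorem add_mem_box (hβ : β ∈ box s) (hγ : γ ∈ box t) : β + γ ∈ box (s + t) := by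
  rw [mem_box] at *
  intro i
  push_cast
  exact (abs_add_le _ _).trans (add_le_add (hβ i) (hγ i))

theorem box_mono (hst : s ≤ t) : box s ⊆ box t := fun β hβ =>
  mem_box.2 fun i => (mem_box.1 hβ i).trans (by exact_mod_cast hst)

end Box

theorem card_centers : centers.card = 6 := by decide

theorem neg_mem_centers {z : Freq} (hz : z ∈ centers) : -z ∈ centers := by
  revert z; decide

theorem node_neg (M s : ℕ) (z β : Freq) : node M s (-z) (-β) = -node M s z β := by
  funext i; simp only [node, Pi.neg_apply]; ring

theorem node_add (M s : ℕ) (z w β γ : Freq) :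
    node M s z β + node M s w γ = node M s (z + w) (β + γ) := by
  funext i; simp only [node, Pi.add_apply]; ring

section NodeInjective

variable {M s : ℕ} (hM : 0 < M)
include hM

theorem node_injective (z : Freq) : Function.Injective (node M s z) := by
  intro β γ h
  funext i
  have cancel_spacing := mul_left_cancel₀ (by exact_mod_cast hM.ne') (congrFun h i)
  linarith

-- The clusters are `8 * s` apart and three offsets contribute at most `6 * s`.
theorem add_eq_of_node_add_node_eq (hs : 0 < s) {z₁ z₂ z₃ β₁ β₂ β₃ : Freq}
    (h₁ : β₁ ∈ box (2 * s)) (h₂ : β₂ ∈ box (2 * s)) (h₃ : β₃ ∈ box (2 * s))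
    (h : node M s z₁ β₁ + node M s z₂ β₂ = node M s z₃ β₃) : z₁ + z₂ = z₃ := by
  funext i
  rw [node_add] at h
  have cancel_spacing := mul_left_cancel₀ (by exact_mod_cast hM.ne') (congrFun h i)
  have bound₁ := abs_le.1 (mem_box.1 h₁ i)
  have bound₂ := abs_le.1 (mem_box.1 h₂ i)
  have bound₃ := abs_le.1 (mem_box.1 h₃ i)
  simp only [Pi.add_apply] at cancel_spacing ⊢
  push_cast at bound₁ bound₂ bound₃
  zify at hs
  have upper : z₁ i + z₂ i - z₃ i < 1 := by
    by_contra! hc; nlinarith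
  have lower : -1 < z₁ i + z₂ i - z₃ i := by
    by_contra! hc; nlinarith
  omega

end NodeInjective

section Block

variable {M s : ℕ} {α : Freq}

theorem exists_of_mem_block (h : α ∈ block M s) :
    ∃ z ∈ centers, ∃ β ∈ box (2 * s), α = node M s z β := by
  simp only [block, blockIndex, Finset.mem_image, Finset.mem_product] at h
  obtain ⟨⟨z, j, l⟩, ⟨hz, hj, hl⟩, rfl⟩ := h
  exact ⟨z, hz, j + l, by rw [two_mul]; exact add_mem_box hj hl, rfl⟩

theorem node_mem_block {z β : Freq} (hz : z ∈ centers) (hβ : β ∈ box s) :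
    node M s z β ∈ block M s :=
  Finset.mem_image.2 ⟨(z, β, 0), Finset.mem_product.2 ⟨hz, Finset.mem_product.2
    ⟨hβ, zero_mem_box s⟩⟩, by simp only [blockFreq, add_zero]⟩

theorem neg_mem_blockIndex {t : Freq × Freq × Freq} (h : t ∈ blockIndex s) :
    -t ∈ blockIndex s := by
  simp only [blockIndex, Finset.mem_product] at *
  exact ⟨neg_mem_centers h.1, neg_mem_box h.2.1, neg_mem_box h.2.2⟩

theorem blockFreq_neg (M s : ℕ) (t : Freq × Freq × Freq) :
    blockFreq M s (-t) = -blockFreq M s t := by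
  simp only [blockFreq, ← node_neg, Prod.fst_neg, Prod.snd_neg, neg_add]

theorem neg_mem_block (h : α ∈ block M s) : -α ∈ block M s := by
  obtain ⟨t, ht, rfl⟩ := Finset.mem_image.1 h
  exact Finset.mem_image.2 ⟨-t, neg_mem_blockIndex ht, blockFreq_neg M s t⟩

theorem multiplicity_neg (M s : ℕ) (α : Freq) : multiplicity M s (-α) = multiplicity M s α := by
  have neg_mem : ∀ α t, t ∈ (blockIndex s).filter (fun t => blockFreq M s t = α) →
      -t ∈ (blockIndex s).filter fun t => blockFreq M s t = -α := by
    intro α t ht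
    rw [Finset.mem_filter] at *
    exact ⟨neg_mem_blockIndex ht.1, by rw [blockFreq_neg, ht.2]⟩
  exact Finset.card_nbij' (fun t => -t) (fun t => -t)
    (fun t ht => by simpa using neg_mem _ t ht) (neg_mem α)
    (fun t _ => neg_neg t) (fun t _ => neg_neg t)

theorem multiplicity_eq_zero (h : α ∉ block M s) : multiplicity M s α = 0 := by
  rw [multiplicity, Finset.card_eq_zero, Finset.filter_eq_empty_iff]
  exact fun t ht h' => h (Finset.mem_image.2 ⟨t, ht, h'⟩)

theorem sum_block {E : Type*} [AddCommMonoid E] (M s : ℕ) (f : Freq → E) :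
    ∑ α ∈ block M s, multiplicity M s α • f α = ∑ t ∈ blockIndex s, f (blockFreq M s t) :=
  (Finset.sum_comp f (blockFreq M s)).symm

theorem abs_le_of_mem_block (h : α ∈ block M s) (i : Fin 2) : |α i| ≤ 74 * (M * s : ℕ) := by
  obtain ⟨z, hz, β, hβ, rfl⟩ := exists_of_mem_block h
  have abs_center_le : ∀ z ∈ centers, ∀ i, |z i| ≤ 9 := by decide
  have hzi := abs_center_le z hz i
  have hβi := mem_box.1 hβ i
  push_cast at hβi ⊢
  calc |(M : ℤ) * (8 * s * z i + β i)| = M * |8 * (s : ℤ) * z i + β i| := by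
        rw [abs_mul, Nat.abs_cast]
    _ ≤ M * (8 * s * |z i| + |β i|) := by
        gcongr
        exact (abs_add_le _ _).trans_eq (by rw [abs_mul, abs_of_nonneg (by positivity)])
    _ ≤ M * (8 * s * 9 + 2 * s) := by gcongr
    _ = _ := by ring

theorem le_abs_of_mem_block (h : α ∈ block M s) : 22 * ((M * s : ℕ) : ℤ) ≤ |α 0| := by
  obtain ⟨z, hz, β, hβ, rfl⟩ := exists_of_mem_block h
  have le_abs_center : ∀ z ∈ centers, 3 ≤ |z 0| := by decide
  have hz₀ := le_abs_center z hz
  have hβ₀ := mem_box.1 hβ 0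
  push_cast at hβ₀ ⊢
  calc 22 * ((M : ℤ) * s) = M * (8 * s * 3 - 2 * s) := by ring
    _ ≤ M * (8 * s * |z 0| - |β 0|) := by gcongr
    _ ≤ M * |8 * (s : ℤ) * z 0 + β 0| := by
        gcongr
        refine le_trans (le_of_eq ?_) (abs_sub_abs_le_abs_add _ _)
        rw [abs_mul, abs_of_nonneg (by positivity : (0 : ℤ) ≤ 8 * s)]
    _ = _ := by rw [node, abs_mul, Nat.abs_cast]

theorem dvd_of_mem_block (h : α ∈ block M s) (i : Fin 2) : (M : ℤ) ∣ α i := by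
  obtain ⟨z, -, β, -, rfl⟩ := exists_of_mem_block h
  exact dvd_mul_right _ _

-- A representation is determined by its centre and its first offset.
theorem multiplicity_le (hM : 0 < M) (hs : 0 < s) (α : Freq) :
    multiplicity M s α ≤ 54 * s ^ 2 := by
  have le_card : multiplicity M s α ≤ (centers ×ˢ box s).card := by
    refine Finset.card_le_card_of_injOn (fun t => (t.1, t.2.1)) ?_ ?_
    · rintro ⟨z, j, l⟩ ht
      simp only [blockIndex, Finset.coe_filter, Finset.mem_product, Set.mem_ofPred_eq] at ht
      simp [ht.1.1, ht.1.2.1]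
    · rintro ⟨z, j, l⟩ ht ⟨z', j', l'⟩ ht' h
      simp only [Prod.mk.injEq] at h
      obtain ⟨rfl, rfl⟩ := h
      simp only [Finset.coe_filter, Set.mem_ofPred_eq] at ht ht'
      simpa using node_injective hM _ (ht.2.trans ht'.2.symm)
  refine le_card.trans ?_
  rw [Finset.card_product, card_centers, card_box]
  nlinarith

theorem card_block_le (hs : 0 < s) : (block M s).card ≤ 150 * s ^ 2 := by
  have subset_image : block M s ⊆ (centers ×ˢ box (2 * s)).image fun p => node M s p.1 p.2 := by
    intro α hα
    obtain ⟨z, hz, β, hβ, rfl⟩ := exists_of_mem_block hα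
    exact Finset.mem_image.2 ⟨(z, β), Finset.mem_product.2 ⟨hz, hβ⟩, rfl⟩
  refine (Finset.card_le_card subset_image).trans (Finset.card_image_le.trans ?_)
  rw [Finset.card_product, card_centers, card_box]
  nlinarith

theorem le_multiplicity {τ : ℕ} {z β : Freq} (hz : z ∈ centers) (hβ : β ∈ box (2 * τ)) :
    (4 * τ) ^ 2 ≤ multiplicity M (4 * τ) (node M (4 * τ) z β) := by
  have card_le : (box (2 * τ)).card ≤ multiplicity M (4 * τ) (node M (4 * τ) z β) := by
    refine Finset.card_le_card_of_injOn (fun j => (z, j, β - j)) (fun j hj => ?_)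
      fun j _ j' _ h => congrArg (fun t : Freq × Freq × Freq => t.2.1) h
    have sub_mem : β - j ∈ box (4 * τ) := by
      rw [sub_eq_add_neg, show 4 * τ = 2 * τ + 2 * τ by ring]
      exact add_mem_box hβ (neg_mem_box hj)
    refine Finset.mem_coe.2 (Finset.mem_filter.2 ⟨?_, by simp [blockFreq]⟩)
    exact Finset.mem_product.2 ⟨hz, Finset.mem_product.2 ⟨box_mono (by omega) hj, sub_mem⟩⟩
  refine le_trans ?_ card_le
  rw [card_box]
  gcongr
  omega

end Block

/-! ### Interactions of Fourier modes -/

/-- The frequency turned by a right angle. -/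
def perp (α : Freq) : Fin 2 → ℝ := ![(α 1 : ℝ), -(α 0 : ℝ)]

/-- Fourier coefficients of the velocity field whose stream function has coefficients proportional
to `ψ`. -/
def velCoeff (ψ : Freq → ℝ) (i : Fin 2) (α : Freq) : ℂ := Complex.I * ((perp α i * ψ α : ℝ) : ℂ)

/-- Fourier coefficients of the derivative `∂_j u_i` of the velocity field with coefficients
`velCoeff ψ`. -/
def gradCoeff (ψ : Freq → ℝ) (i j : Fin 2) (α : Freq) : ℂ :=
  2 * Real.pi * Complex.I * α j * velCoeff ψ i α

/-- The cross product of two frequencies. -/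
def cross (b c : Freq) : ℤ := b 0 * c 1 - b 1 * c 0

/-- The contribution of the modes `b` and `c` to the trilinear form `∫ v · (u · ∇) w`, where `u`,
`v`, `w` have stream coefficients `ψ₂`, `ψ₁`, `ψ₃`. The mode `-(b + c)` of `v` is weighted by the
even function `κ`. -/
def interaction (κ ψ₁ ψ₂ ψ₃ : Freq → ℝ) (b c : Freq) : ℝ :=
  2 * Real.pi * (cross b c * ((b + c) ⬝ᵥ c) : ℤ) * (κ (b + c) * ψ₁ (b + c) * ψ₂ b * ψ₃ c)

/-- The coefficient with which the modes `b` and `c` of one field feed energy into the mode `b + c`,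
after symmetrization in `b` and `c`. -/
def transfer (b c : Freq) : ℤ := cross b c * (c ⬝ᵥ c - b ⬝ᵥ b)

/-- The interaction of the modes `b` and `c` of one field, symmetrized in `b` and `c`. -/
def symmInteraction (κ ψ : Freq → ℝ) (b c : Freq) : ℝ :=
  Real.pi * transfer b c * (κ (b + c) * ψ (b + c) * ψ b * ψ c)

section Coefficients

variable {ψ : Freq → ℝ} {α : Freq}

theorem gradCoeff_eq_ofReal (ψ : Freq → ℝ) (i j : Fin 2) (α : Freq) :
    gradCoeff ψ i j α = ((-(2 * Real.pi) * (α j * perp α i * ψ α) : ℝ) : ℂ) := by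
  rw [gradCoeff, velCoeff]
  push_cast
  linear_combination (2 * Real.pi * α j * (perp α i * ψ α : ℂ)) * Complex.I_mul_I

theorem perp_neg (α : Freq) (i : Fin 2) : perp (-α) i = -perp α i := by
  fin_cases i <;> simp [perp]

theorem perp_add (α β : Freq) (i : Fin 2) : perp (α + β) i = perp α i + perp β i := by
  fin_cases i
  · simp [perp]
  · simp [perp]; ring

theorem velCoeff_neg (hψ : ∀ α, ψ (-α) = ψ α) (i : Fin 2) (α : Freq) :
    velCoeff ψ i (-α) = conj (velCoeff ψ i α) := by
  rw [velCoeff, velCoeff, perp_neg, hψ, map_mul, Complex.conj_I, Complex.conj_ofReal]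
  push_cast
  ring

theorem gradCoeff_neg (hψ : ∀ α, ψ (-α) = ψ α) (i j : Fin 2) (α : Freq) :
    gradCoeff ψ i j (-α) = conj (gradCoeff ψ i j α) := by
  rw [gradCoeff_eq_ofReal, gradCoeff_eq_ofReal, perp_neg, hψ, Complex.conj_ofReal]
  simp

theorem velCoeff_eq_zero (hα : ψ α = 0) (i : Fin 2) : velCoeff ψ i α = 0 := by
  simp [velCoeff, hα]

theorem sum_gradCoeff_diag (ψ : Freq → ℝ) (α : Freq) : ∑ j, gradCoeff ψ j j α = 0 := by
  simp only [gradCoeff_eq_ofReal, Fin.sum_univ_two, perp]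
  push_cast
  simp
  ring

variable {R W : ℝ}

theorem abs_perp_le (hα : ∀ i, |(α i : ℝ)| ≤ R) (i : Fin 2) : |perp α i| ≤ R := by
  fin_cases i
  · simpa [perp] using hα 1
  · simpa [perp] using hα 0

theorem norm_velCoeff_le (hα : ∀ i, |(α i : ℝ)| ≤ R) (hψ : |ψ α| ≤ W) (i : Fin 2) :
    ‖velCoeff ψ i α‖ ≤ R * W := by
  rw [velCoeff, norm_mul, Complex.norm_I, one_mul, Complex.norm_real, Real.norm_eq_abs, abs_mul]
  exact mul_le_mul (abs_perp_le hα i) hψ (abs_nonneg _) ((abs_nonneg _).trans (hα 0))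

theorem norm_gradCoeff_le (hα : ∀ i, |(α i : ℝ)| ≤ R) (hψ : |ψ α| ≤ W) (i j : Fin 2) :
    ‖gradCoeff ψ i j α‖ ≤ 2 * Real.pi * (R * (R * W)) := by
  have norm_two_pi_I : ‖2 * Real.pi * Complex.I‖ = 2 * Real.pi := by
    simp [abs_of_pos Real.pi_pos]
  rw [gradCoeff, norm_mul, norm_mul, norm_two_pi_I, Complex.norm_intCast, mul_assoc]
  gcongr
  exacts [(abs_nonneg _).trans (hα 0), hα j, norm_velCoeff_le hα hψ i]

end Coefficients

section Interaction

theorem cross_swap (b c : Freq) : cross c b = -cross b c := by simp only [cross]; ring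

theorem transfer_swap (b c : Freq) : transfer c b = transfer b c := by
  simp only [transfer, cross_swap b c]; ring

theorem transfer_neg_neg (b c : Freq) : transfer (-b) (-c) = transfer b c := by
  simp only [transfer, cross, neg_dotProduct_neg, Pi.neg_apply]; ring

theorem sum_velCoeff_mul_velCoeff_mul_gradCoeff (ψ₁ ψ₂ ψ₃ : Freq → ℝ) (b c : Freq) :
    ∑ i, ∑ j, velCoeff ψ₁ i (-(b + c)) * (velCoeff ψ₂ j b * gradCoeff ψ₃ i j c) =
      ((2 * Real.pi * (cross b c * ((b + c) ⬝ᵥ c) : ℤ) * (ψ₁ (-(b + c)) * ψ₂ b * ψ₃ c) : ℝ) :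
        ℂ) := by
  simp only [gradCoeff_eq_ofReal, velCoeff, Fin.sum_univ_two, perp, cross, dotProduct,
    Pi.neg_apply, Pi.add_apply]
  push_cast
  linear_combination -(2 * Real.pi * ((b 0 * c 1 - b 1 * c 0) * ((b 0 + c 0) * c 0 +
    (b 1 + c 1) * c 1)) * (ψ₁ (-(b + c)) * ψ₂ b * ψ₃ c) : ℂ) * Complex.I_mul_I

theorem sum_integral_trilinear {κ ψ₁ : Freq → ℝ} {s₁ : Finset Freq} (ψ₂ ψ₃ : Freq → ℝ)
    (s₂ s₃ : Finset Freq) (hs₁ : ∀ α ∉ s₁, ψ₁ α = 0) (hψ₁ : ∀ α, ψ₁ (-α) = ψ₁ α)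
    (hκ : ∀ α, κ (-α) = κ α) :
    ∑ i, ∑ j, ∫ x, trigPoly s₁ (fun α => κ α * velCoeff ψ₁ i α) x *
      (trigPoly s₂ (velCoeff ψ₂ j) x * trigPoly s₃ (gradCoeff ψ₃ i j) x) ∂torusMeasure =
    ((∑ b ∈ s₂, ∑ c ∈ s₃, interaction κ ψ₁ ψ₂ ψ₃ b c : ℝ) : ℂ) := by
  have weighted_eq_zero : ∀ i, ∀ α ∉ s₁, κ α * velCoeff ψ₁ i α = 0 := fun i α hα => by
    rw [velCoeff_eq_zero (hs₁ α hα), mul_zero]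
  simp_rw [fun i j => integral_trigPoly_mul_trigPoly_mul_trigPoly s₂ s₃ (velCoeff ψ₂ j)
    (gradCoeff ψ₃ i j) (weighted_eq_zero i)]
  have sum_swap : ∀ F : Fin 2 → Fin 2 → Freq → Freq → ℂ,
      ∑ i, ∑ j, ∑ b ∈ s₂, ∑ c ∈ s₃, F i j b c = ∑ b ∈ s₂, ∑ c ∈ s₃, ∑ i, ∑ j, F i j b c := by
    intro F
    simp only [Fin.sum_univ_two, Finset.sum_add_distrib]
  rw [sum_swap]
  push_cast
  refine Finset.sum_congr rfl fun b _ => Finset.sum_congr rfl fun c _ => ?_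
  have contracted := sum_velCoeff_mul_velCoeff_mul_gradCoeff ψ₁ ψ₂ ψ₃ b c
  simp only [mul_assoc, ← Finset.mul_sum] at contracted ⊢
  rw [contracted, hψ₁, hκ, interaction]
  push_cast
  ring

theorem sum_interaction_eq (κ ψ : Freq → ℝ) (s : Finset Freq) :
    ∑ b ∈ s, ∑ c ∈ s, interaction κ ψ ψ ψ b c =
      ∑ b ∈ s, ∑ c ∈ s, symmInteraction κ ψ b c := by
  have sum_comm : ∑ b ∈ s, ∑ c ∈ s, interaction κ ψ ψ ψ b c =
      ∑ b ∈ s, ∑ c ∈ s, interaction κ ψ ψ ψ c b := Finset.sum_comm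
  have symmetrized : ∑ b ∈ s, ∑ c ∈ s, (interaction κ ψ ψ ψ b c + interaction κ ψ ψ ψ c b) =
      ∑ b ∈ s, ∑ c ∈ s, 2 * symmInteraction κ ψ b c := by
    refine Finset.sum_congr rfl fun b _ => Finset.sum_congr rfl fun c _ => ?_
    simp only [interaction, symmInteraction, transfer, add_comm c b, cross_swap b c,
      add_dotProduct, dotProduct_comm c b]
    push_cast
    ring
  simp only [Finset.sum_add_distrib, ← sum_comm, ← Finset.mul_sum] at symmetrized
  linarith

-- For a fixed transporting mode `b`, the reflection `c ↦ -(b + c)` reverses the sign of the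
-- interaction.
theorem sum_interaction_eq_zero {κ ψ : Freq → ℝ} {s : Finset Freq} (hs : ∀ α ∉ s, ψ α = 0)
    (hneg : ∀ α ∈ s, -α ∈ s) (hψ : ∀ α, ψ (-α) = ψ α) (hκ : ∀ α ∈ s, κ α = 1) :
    ∑ b ∈ s, ∑ c ∈ s, interaction κ ψ ψ ψ b c = 0 := by
  refine Finset.sum_eq_zero fun b _ => ?_
  have sum_resonant : ∑ c ∈ s.filter (fun c => -(b + c) ∈ s), interaction κ ψ ψ ψ b c =
      ∑ c ∈ s, interaction κ ψ ψ ψ b c := by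
    refine Finset.sum_filter_of_ne fun c _ hne => ?_
    by_contra hc
    exact hne (by rw [interaction, ← hψ (b + c), hs _ hc]; ring)
  rw [← sum_resonant]
  have antisymm : ∀ c ∈ s.filter (fun c => -(b + c) ∈ s),
      interaction κ ψ ψ ψ b c + interaction κ ψ ψ ψ b (-(b + c)) = 0 := by
    intro c hc
    obtain ⟨hc, hbc⟩ := Finset.mem_filter.1 hc
    have hκc : κ (-c) = 1 := hκ _ (hneg c hc)
    have hκbc : κ (b + c) = 1 := hκ _ (by simpa using hneg _ hbc)
    rw [interaction, interaction, show b + -(b + c) = -c by abel, hκc, hκbc, hψ, hψ]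
    simp only [cross, dotProduct, Fin.sum_univ_two, Pi.neg_apply, Pi.add_apply]
    push_cast
    ring
  refine Finset.sum_involution (fun c _ => -(b + c)) antisymm ?_ ?_ fun c _ => by abel
  · intro c hc hne heq
    have := antisymm c hc
    rw [heq] at this
    exact hne (by linarith)
  · intro c hc
    rw [Finset.mem_filter] at *
    exact ⟨hc.2, by rw [show -(b + -(b + c)) = c by abel]; exact hc.1⟩

end Interaction

/-! ### Energy transfer inside one block -/

/-- Stream coefficients of a block, with amplitude `D`. -/
def stream (D : ℝ) (M s : ℕ) (α : Freq) : ℝ := D * multiplicity M s α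

/-- The truncation `κ` keeps the inner clusters of a block and removes the others. -/
structure KeepsInner (κ : Freq → ℝ) (M s : ℕ) : Prop where
  eq_one : ∀ z ∈ innerCenters, ∀ β ∈ box (2 * s), κ (node M s z β) = 1
  eq_zero : ∀ z ∈ centers, z ∉ innerCenters → ∀ β ∈ box (2 * s), κ (node M s z β) = 0

section Stream

variable {D : ℝ} {M s : ℕ} {α : Freq}

theorem stream_neg (D : ℝ) (M s : ℕ) (α : Freq) : stream D M s (-α) = stream D M s α := by
  rw [stream, stream, multiplicity_neg]

theorem stream_eq_zero (D : ℝ) (h : α ∉ block M s) : stream D M s α = 0 := by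
  rw [stream, multiplicity_eq_zero h, Nat.cast_zero, mul_zero]

theorem stream_nonneg (hD : 0 ≤ D) (M s : ℕ) (α : Freq) : 0 ≤ stream D M s α :=
  mul_nonneg hD (Nat.cast_nonneg _)

theorem abs_stream_le (hD : 0 ≤ D) (hM : 0 < M) (hs : 0 < s) (α : Freq) :
    |stream D M s α| ≤ 54 * D * s ^ 2 := by
  rw [abs_of_nonneg (stream_nonneg hD _ _ _), stream, mul_comm 54, mul_assoc]
  gcongr
  exact_mod_cast multiplicity_le hM hs α

theorem le_stream_node (hD : 0 ≤ D) {τ : ℕ} {z β : Freq} (hz : z ∈ centers)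
    (hβ : β ∈ box (2 * τ)) : D * (4 * τ) ^ 2 ≤ stream D M (4 * τ) (node M (4 * τ) z β) := by
  rw [stream]
  gcongr
  exact_mod_cast le_multiplicity hz hβ

end Stream

section Transfer

variable {M s : ℕ}

section Node

variable {β γ : Freq} (hβ : β ∈ box (2 * s)) (hγ : γ ∈ box (2 * s))
include hβ hγ

theorem sq_le_cross_node :
    ((M * s : ℕ) : ℤ) ^ 2 ≤ cross (node M s ![3, 9] β) (node M s ![-6, -9] γ) := by
  have hβ₀ := abs_le.1 (mem_box.1 hβ 0)
  have hβ₁ := abs_le.1 (mem_box.1 hβ 1)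
  have hγ₀ := abs_le.1 (mem_box.1 hγ 0)
  have hγ₁ := abs_le.1 (mem_box.1 hγ 1)
  push_cast at *
  have hs : (0 : ℤ) ≤ s := by positivity
  have unscaled : (s : ℤ) ^ 2 ≤ (8 * s * 3 + β 0) * (8 * s * -9 + γ 1) -
      (8 * s * 9 + β 1) * (8 * s * -6 + γ 0) := by
    have cross_offset_ge : -(4 * (s : ℤ) ^ 2) ≤ β 0 * γ 1 := by nlinarith
    have cross_offset_le : β 1 * γ 0 ≤ 4 * (s : ℤ) ^ 2 := by nlinarith
    nlinarith [mul_nonneg hs (sub_nonneg.2 hβ₀.2), mul_nonneg hs (sub_nonneg.2 hβ₁.1),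
      mul_nonneg hs (sub_nonneg.2 hγ₀.2), mul_nonneg hs (sub_nonneg.2 hγ₁.1)]
  calc ((M : ℤ) * s) ^ 2 = M ^ 2 * s ^ 2 := by ring
    _ ≤ _ := mul_le_mul_of_nonneg_left unscaled (sq_nonneg (M : ℤ))
    _ = _ := by simp only [cross, node, Matrix.cons_val_zero, Matrix.cons_val_one]; ring

theorem sq_le_dotProduct_self_node_sub :
    ((M * s : ℕ) : ℤ) ^ 2 ≤ node M s ![-6, -9] γ ⬝ᵥ node M s ![-6, -9] γ -
      node M s ![3, 9] β ⬝ᵥ node M s ![3, 9] β := by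
  have hβ₀ := abs_le.1 (mem_box.1 hβ 0)
  have hβ₁ := abs_le.1 (mem_box.1 hβ 1)
  have hγ₀ := abs_le.1 (mem_box.1 hγ 0)
  have hγ₁ := abs_le.1 (mem_box.1 hγ 1)
  push_cast at *
  have hs : (0 : ℤ) ≤ s := by positivity
  have unscaled : (s : ℤ) ^ 2 ≤ (8 * s * -6 + γ 0) ^ 2 + (8 * s * -9 + γ 1) ^ 2 -
      ((8 * s * 3 + β 0) ^ 2 + (8 * s * 9 + β 1) ^ 2) := by
    have sq_offset₀ : β 0 ^ 2 ≤ 4 * (s : ℤ) ^ 2 := by nlinarith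
    have sq_offset₁ : β 1 ^ 2 ≤ 4 * (s : ℤ) ^ 2 := by nlinarith
    nlinarith [mul_nonneg hs (sub_nonneg.2 hβ₀.2), mul_nonneg hs (sub_nonneg.2 hβ₁.2),
      mul_nonneg hs (sub_nonneg.2 hγ₀.2), mul_nonneg hs (sub_nonneg.2 hγ₁.2),
      sq_nonneg (γ 0), sq_nonneg (γ 1)]
  calc ((M : ℤ) * s) ^ 2 = M ^ 2 * s ^ 2 := by ring
    _ ≤ _ := mul_le_mul_of_nonneg_left unscaled (sq_nonneg (M : ℤ))
    _ = _ := by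
      simp only [dotProduct, Fin.sum_univ_two, node, Matrix.cons_val_zero, Matrix.cons_val_one]
      ring

theorem pow_four_le_transfer_node :
    ((M * s : ℕ) : ℤ) ^ 4 ≤ transfer (node M s ![3, 9] β) (node M s ![-6, -9] γ) :=
  calc ((M * s : ℕ) : ℤ) ^ 4 = ((M * s : ℕ) : ℤ) ^ 2 * ((M * s : ℕ) : ℤ) ^ 2 := by ring
    _ ≤ _ := mul_le_mul (sq_le_cross_node hβ hγ) (sq_le_dotProduct_self_node_sub hβ hγ)
      (sq_nonneg _) ((sq_nonneg _).trans (sq_le_cross_node hβ hγ))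

theorem transfer_node_nonneg :
    0 ≤ transfer (node M s ![3, 9] β) (node M s ![-6, -9] γ) :=
  (by positivity : (0 : ℤ) ≤ _).trans (pow_four_le_transfer_node hβ hγ)

end Node

-- Up to order and sign, `(3, 9)` and `(-6, -9)` are the only centres whose sum is inner.
theorem transfer_nonneg (hM : 0 < M) (hs : 0 < s) {b c : Freq} (hb : b ∈ block M s)
    (hc : c ∈ block M s) {z γ : Freq} (hz : z ∈ innerCenters) (hγ : γ ∈ box (2 * s))
    (hbc : b + c = node M s z γ) : 0 ≤ transfer b c := by
  obtain ⟨z₁, hz₁, β₁, hβ₁, rfl⟩ := exists_of_mem_block hb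
  obtain ⟨z₂, hz₂, β₂, hβ₂, rfl⟩ := exists_of_mem_block hc
  have center_cases : ∀ z₁ ∈ centers, ∀ z₂ ∈ centers, z₁ + z₂ ∈ innerCenters →
      (z₁ = ![3, 9] ∧ z₂ = ![-6, -9]) ∨ (z₁ = ![-6, -9] ∧ z₂ = ![3, 9]) ∨
      (-z₁ = ![3, 9] ∧ -z₂ = ![-6, -9]) ∨ (-z₁ = ![-6, -9] ∧ -z₂ = ![3, 9]) := by decide
  rw [← add_eq_of_node_add_node_eq hM hs hβ₁ hβ₂ hγ hbc] at hz
  rcases center_cases z₁ hz₁ z₂ hz₂ hz with ⟨h₁, h₂⟩ | ⟨h₁, h₂⟩ | ⟨h₁, h₂⟩ | ⟨h₁, h₂⟩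
  · rw [h₁, h₂]
    exact transfer_node_nonneg hβ₁ hβ₂
  · rw [h₁, h₂, ← transfer_swap]
    exact transfer_node_nonneg hβ₂ hβ₁
  · rw [← transfer_neg_neg, ← node_neg, ← node_neg, h₁, h₂]
    exact transfer_node_nonneg (neg_mem_box hβ₁) (neg_mem_box hβ₂)
  · rw [← transfer_neg_neg, ← transfer_swap, ← node_neg, ← node_neg, h₁, h₂]
    exact transfer_node_nonneg (neg_mem_box hβ₂) (neg_mem_box hβ₁)

variable {κ : Freq → ℝ} {D : ℝ}

theorem symmInteraction_nonneg (hD : 0 ≤ D) (hM : 0 < M) (hs : 0 < s) (hκ : KeepsInner κ M s)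
    {b c : Freq} (hb : b ∈ block M s) (hc : c ∈ block M s) :
    0 ≤ symmInteraction κ (stream D M s) b c := by
  rw [symmInteraction]
  by_cases hbc : b + c ∈ block M s
  · obtain ⟨z, hz, γ, hγ, hsum⟩ := exists_of_mem_block hbc
    by_cases hinner : z ∈ innerCenters
    · have transfer_nonneg : (0 : ℝ) ≤ transfer b c := by
        exact_mod_cast transfer_nonneg hM hs hb hc hinner hγ hsum
      have hψ := stream_nonneg hD M s
      rw [hsum, hκ.eq_one z hinner γ hγ, one_mul]
      exact mul_nonneg (mul_nonneg Real.pi_pos.le transfer_nonneg)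
        (mul_nonneg (mul_nonneg (hψ _) (hψ _)) (hψ _))
    · rw [hsum, hκ.eq_zero z hz hinner γ hγ]
      simp only [zero_mul, mul_zero, le_refl]
  · rw [stream_eq_zero D hbc]
    simp only [zero_mul, mul_zero, le_refl]

variable {τ : ℕ}

theorem le_symmInteraction_node (hD : 0 ≤ D) (hκ : KeepsInner κ M (4 * τ)) {β γ : Freq}
    (hβ : β ∈ box τ) (hγ : γ ∈ box τ) :
    Real.pi * (M * (4 * τ)) ^ 4 * (D * (4 * τ) ^ 2) ^ 3 ≤
      symmInteraction κ (stream D M (4 * τ)) (node M (4 * τ) ![3, 9] β)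
        (node M (4 * τ) ![-6, -9] γ) := by
  have hβγ : β + γ ∈ box (2 * τ) := by rw [two_mul]; exact add_mem_box hβ hγ
  have hsum : node M (4 * τ) ![3, 9] β + node M (4 * τ) ![-6, -9] γ =
      node M (4 * τ) ![-3, 0] (β + γ) := by
    rw [node_add, show ![3, 9] + ![-6, -9] = (![-3, 0] : Freq) by decide]
  rw [symmInteraction, hsum, hκ.eq_one _ (by decide) _ (box_mono (by omega) hβγ), one_mul]
  have coupling_ge : ((M : ℝ) * (4 * τ)) ^ 4 ≤
      transfer (node M (4 * τ) ![3, 9] β) (node M (4 * τ) ![-6, -9] γ) := by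
    exact_mod_cast pow_four_le_transfer_node (M := M) (box_mono (by omega) hβ)
      (box_mono (by omega) hγ)
  have amplitude_ge : ∀ z ∈ centers, ∀ δ ∈ box (2 * τ), D * (4 * τ) ^ 2 ≤
      stream D M (4 * τ) (node M (4 * τ) z δ) := fun z hz δ hδ => le_stream_node hD hz hδ
  have hψ := stream_nonneg hD M (4 * τ)
  rw [pow_three']
  gcongr
  · exact mul_nonneg Real.pi_pos.le ((by positivity : (0 : ℝ) ≤ _).trans coupling_ge)
  · exact mul_nonneg (hψ _) (hψ _)
  · exact hψ _
  · exact amplitude_ge _ (by decide) _ hβγ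
  · exact amplitude_ge _ (by decide) _ (box_mono (by omega) hβ)
  · exact amplitude_ge _ (by decide) _ (box_mono (by omega) hγ)

-- Every term is nonnegative; those whose factors both lie in the core `box τ` of their cluster
-- have large coefficients.
theorem le_sum_interaction (hD : 0 ≤ D) (hM : 0 < M) (hτ : 0 < τ)
    (hκ : KeepsInner κ M (4 * τ)) :
    Real.pi * (M * (4 * τ)) ^ 4 * (D * (4 * τ) ^ 2) ^ 3 * (2 * τ) ^ 4 ≤
      ∑ b ∈ block M (4 * τ), ∑ c ∈ block M (4 * τ), interaction κ (stream D M (4 * τ))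
        (stream D M (4 * τ)) (stream D M (4 * τ)) b c := by
  set corePair : Freq × Freq → Freq × Freq := fun p =>
    (node M (4 * τ) ![3, 9] p.1, node M (4 * τ) ![-6, -9] p.2)
  have corePair_injective : Function.Injective corePair :=
    (node_injective hM _).prodMap (node_injective hM _)
  have hτs : τ ≤ 4 * τ := by omega
  have core_subset : (box τ ×ˢ box τ).image corePair ⊆ block M (4 * τ) ×ˢ block M (4 * τ) := by
    intro p hp
    obtain ⟨⟨β, γ⟩, hq, rfl⟩ := Finset.mem_image.1 hp
    obtain ⟨hβ, hγ⟩ := Finset.mem_product.1 hq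
    exact Finset.mem_product.2 ⟨node_mem_block (by decide) (box_mono hτs hβ),
      node_mem_block (by decide) (box_mono hτs hγ)⟩
  have le_card : ((2 : ℝ) * τ) ^ 4 ≤ ((box τ ×ˢ box τ).card : ℝ) := by
    rw [Finset.card_product, card_box, ← pow_add]
    push_cast
    gcongr
    linarith
  rw [sum_interaction_eq, ← Finset.sum_product']
  refine le_trans ?_ (Finset.sum_le_sum_of_subset_of_nonneg core_subset fun p hp _ =>
    symmInteraction_nonneg hD hM (by omega) hκ (Finset.mem_product.1 hp).1
      (Finset.mem_product.1 hp).2)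
  rw [Finset.sum_image fun p _ q _ h => corePair_injective h]
  refine le_trans ?_ (Finset.card_nsmul_le_sum _ _ _ fun p hp =>
    le_symmInteraction_node hD hκ (Finset.mem_product.1 hp).1 (Finset.mem_product.1 hp).2)
  rw [nsmul_eq_mul, mul_comm]
  gcongr

end Transfer

/-! ### The gradient of a block in `L¹` -/

section SquareFactors

variable {d κ : Type*} [Fintype d] {s : Finset κ} {ν ν' : κ → d → ℤ}

theorem integral_norm_sum_mul_mFourier_sq_le (hν : Function.Injective ν) {p : κ → ℂ} {a : ℝ}
    (hp : ∀ k ∈ s, ‖p k‖ ≤ a) :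
    ∫ x, ‖∑ k ∈ s, p k * mFourier (ν k) x‖ ^ 2 ∂torusHaar d ≤ s.card * a ^ 2 := by
  classical
  have sum_eq_trigPoly : ∀ x, ∑ k ∈ s, p k * mFourier (ν k) x =
      trigPoly (s.image ν) (Function.extend ν p 0) x := by
    intro x
    rw [trigPoly, Finset.sum_image fun _ _ _ _ h => hν h]
    simp_rw [hν.extend_apply]
  simp_rw [sum_eq_trigPoly]
  rw [integral_norm_trigPoly_sq, Finset.sum_image fun _ _ _ _ h => hν h, ← nsmul_eq_mul]
  refine Finset.sum_le_card_nsmul _ _ _ fun k hk => ?_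
  rw [hν.extend_apply]
  exact pow_le_pow_left₀ (norm_nonneg _) (hp k hk) 2

theorem integral_norm_sum_mul_sum_le (hν : Function.Injective ν) (hν' : Function.Injective ν')
    {p q : κ → ℂ} {a b : ℝ} (ha : 0 ≤ a) (hb : 0 ≤ b) (hp : ∀ k ∈ s, ‖p k‖ ≤ a)
    (hq : ∀ k ∈ s, ‖q k‖ ≤ b) :
    ∫ x, ‖(∑ k ∈ s, p k * mFourier (ν k) x) * ∑ l ∈ s, q l * mFourier (ν' l) x‖ ∂torusHaar d ≤
      s.card * (a * b) := by
  have memLp_two : ∀ (μ : κ → d → ℤ) (r : κ → ℂ),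
      MemLp (fun x => ∑ k ∈ s, r k * mFourier (μ k) x) 2 (torusHaar d) := fun μ r =>
    Continuous.memLp_of_hasCompactSupport (by fun_prop) (HasCompactSupport.of_compactSpace _)
  have sq_sqrt_mul : ∀ c : ℝ, (s.card : ℝ) * c ^ 2 = (√s.card * c) ^ 2 := fun c => by
    rw [mul_pow, Real.sq_sqrt (Nat.cast_nonneg _)]
  simp_rw [norm_mul]
  refine (integral_norm_mul_norm_le (memLp_two ν p) (memLp_two ν' q)
    (mul_nonneg (Real.sqrt_nonneg _) ha) (mul_nonneg (Real.sqrt_nonneg _) hb)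
    ((integral_norm_sum_mul_mFourier_sq_le hν hp).trans_eq (sq_sqrt_mul a))
    ((integral_norm_sum_mul_mFourier_sq_le hν' hq).trans_eq (sq_sqrt_mul b))).trans_eq ?_
  rw [mul_mul_mul_comm, Real.mul_self_sqrt (Nat.cast_nonneg _)]

-- The sum is the inner product of two vectors of trigonometric polynomials, so Cauchy–Schwarz
-- gains the factor `s.card` over the bound by the sum of the coefficients.
theorem integral_norm_sum_sum_mul_mFourier_le {ι : Type*} [Fintype ι] (hν : Function.Injective ν)
    (hν' : Function.Injective ν') {p q : ι → κ → ℂ} {a b : ι → ℝ} (ha : ∀ n, 0 ≤ a n)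
    (hb : ∀ n, 0 ≤ b n) (hp : ∀ n, ∀ k ∈ s, ‖p n k‖ ≤ a n) (hq : ∀ n, ∀ k ∈ s, ‖q n k‖ ≤ b n) :
    ∫ x, ‖∑ k ∈ s, ∑ l ∈ s, (∑ n, p n k * q n l) * mFourier (ν k + ν' l) x‖ ∂torusHaar d ≤
      s.card * ∑ n, a n * b n := by
  have factor : ∀ x, ∑ k ∈ s, ∑ l ∈ s, (∑ n, p n k * q n l) * mFourier (ν k + ν' l) x =
      ∑ n, (∑ k ∈ s, p n k * mFourier (ν k) x) * ∑ l ∈ s, q n l * mFourier (ν' l) x := by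
    intro x
    symm
    simp_rw [Finset.sum_mul_sum]
    rw [Finset.sum_comm]
    refine Finset.sum_congr rfl fun k _ => ?_
    rw [Finset.sum_comm]
    refine Finset.sum_congr rfl fun l _ => ?_
    rw [Finset.sum_mul]
    exact Finset.sum_congr rfl fun n _ => by rw [mFourier_add]; ring
  simp_rw [factor]
  refine (integral_mono (integrable_of_continuous (by fun_prop))
    (integrable_of_continuous (by fun_prop)) fun x => norm_sum_le _ _).trans ?_
  rw [integral_finsetSum _ fun n _ => integrable_of_continuous (by fun_prop), Finset.mul_sum]
  exact Finset.sum_le_sum fun n _ =>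
    integral_norm_sum_mul_sum_le hν hν' (ha n) (hb n) (hp n) (hq n)

end SquareFactors

section BlockGradient

variable {M s : ℕ}

theorem abs_node_le {z β : Freq} (hz : z ∈ centers) (hβ : β ∈ box s) (i : Fin 2) :
    |(node M s z β i : ℝ)| ≤ 74 * (M * s) := by
  exact_mod_cast abs_le_of_mem_block (node_mem_block (M := M) hz hβ) i

theorem abs_node_zero_le {β : Freq} (hβ : β ∈ box s) (i : Fin 2) :
    |(node M s 0 β i : ℝ)| ≤ 74 * (M * s) := by
  have hβi : |(β i : ℝ)| ≤ s := by exact_mod_cast mem_box.1 hβ i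
  simp only [node, Pi.zero_apply, mul_zero, zero_add]
  push_cast
  rw [abs_mul, Nat.abs_cast]
  calc (M : ℝ) * |(β i : ℝ)| ≤ M * s := by gcongr
    _ ≤ 74 * (M * s) := le_mul_of_one_le_left (by positivity) (by norm_num)

theorem blockFreq_eq_node_add_node (M s : ℕ) (z k l : Freq) :
    blockFreq M s (z, k, l) = node M s z k + node M s 0 l := by
  rw [node_add, add_zero, blockFreq]

theorem integral_norm_cluster_grad_le (hM : 0 < M) {z : Freq} (hz : z ∈ centers) (i j : Fin 2) :
    ∫ x, ‖∑ k ∈ box s, ∑ l ∈ box s, ((blockFreq M s (z, k, l) j *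
      perp (blockFreq M s (z, k, l)) i : ℝ) : ℂ) * mFourier (blockFreq M s (z, k, l)) x‖
      ∂torusMeasure ≤ (2 * s + 1) ^ 2 * (4 * (74 * (M * s)) ^ 2) := by
  set R : ℝ := 74 * (M * s)
  set P : Freq → Freq := node M s z
  set Q : Freq → Freq := node M s 0
  have hP : ∀ k ∈ box s, ∀ i, |(P k i : ℝ)| ≤ R := fun k hk i => abs_node_le hz hk i
  have hQ : ∀ l ∈ box s, ∀ i, |(Q l i : ℝ)| ≤ R := fun l hl i => abs_node_zero_le hl i
  have hR : 0 ≤ R := by positivity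
  -- `(P + Q)_j (P + Q)^⊥_i` is a sum of four products of a function of `k` and a function of `l`.
  set p : Fin 4 → Freq → ℂ := ![fun k => (P k j : ℂ) * perp (P k) i, fun k => P k j,
    fun k => perp (P k) i, fun _ => 1]
  set q : Fin 4 → Freq → ℂ := ![fun _ => 1, fun l => perp (Q l) i, fun l => Q l j,
    fun l => (Q l j : ℂ) * perp (Q l) i]
  have expand : ∀ k l, ((blockFreq M s (z, k, l) j * perp (blockFreq M s (z, k, l)) i : ℝ) : ℂ) =
      ∑ n, p n k * q n l := by
    intro k l
    rw [blockFreq_eq_node_add_node, perp_add, Fin.sum_univ_four]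
    simp only [p, q, Matrix.cons_val, Pi.add_apply]
    push_cast
    ring
  simp_rw [expand, blockFreq_eq_node_add_node]
  refine (integral_norm_sum_sum_mul_mFourier_le (a := ![R * R, R, R, 1]) (b := ![1, R, R, R * R])
    (node_injective hM z) (node_injective hM 0) ?_ ?_ ?_ ?_).trans_eq ?_
  · simp [Fin.forall_fin_succ, hR, mul_nonneg]
  · simp [Fin.forall_fin_succ, hR, mul_nonneg]
  · have norm_mul_perp_le : ∀ k ∈ box s, |(P k j : ℝ)| * |perp (P k) i| ≤ R * R := fun k hk =>
      mul_le_mul (hP k hk j) (abs_perp_le (hP k hk) i) (abs_nonneg _) hR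
    simpa [p, Fin.forall_fin_succ] using
      ⟨norm_mul_perp_le, fun k hk => hP k hk j, fun k hk => abs_perp_le (hP k hk) i⟩
  · have norm_mul_perp_le : ∀ l ∈ box s, |(Q l j : ℝ)| * |perp (Q l) i| ≤ R * R := fun l hl =>
      mul_le_mul (hQ l hl j) (abs_perp_le (hQ l hl) i) (abs_nonneg _) hR
    simpa [q, Fin.forall_fin_succ] using
      ⟨fun l hl => abs_perp_le (hQ l hl) i, fun l hl => hQ l hl j, norm_mul_perp_le⟩
  · rw [card_box, Fin.sum_univ_four]
    simp only [Matrix.cons_val]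
    push_cast
    ring

theorem trigPoly_block_gradCoeff (D : ℝ) (M s : ℕ) (i j : Fin 2) (x : Torus2) :
    trigPoly (block M s) (gradCoeff (stream D M s) i j) x =
      ((-(2 * Real.pi) * D : ℝ) : ℂ) * ∑ z ∈ centers, ∑ k ∈ box s, ∑ l ∈ box s,
        ((blockFreq M s (z, k, l) j * perp (blockFreq M s (z, k, l)) i : ℝ) : ℂ) *
          mFourier (blockFreq M s (z, k, l)) x := by
  have expand : ∀ α, gradCoeff (stream D M s) i j α * mFourier α x =
      ((-(2 * Real.pi) * D : ℝ) : ℂ) *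
        multiplicity M s α • (((α j * perp α i : ℝ) : ℂ) * mFourier α x) := by
    intro α
    rw [gradCoeff_eq_ofReal, stream, nsmul_eq_mul]
    push_cast
    ring
  simp_rw [trigPoly, expand]
  rw [← Finset.mul_sum, sum_block, blockIndex, Finset.sum_product]
  simp_rw [Finset.sum_product]

theorem integral_norm_trigPoly_gradCoeff_stream_le {D : ℝ} (hD : 0 ≤ D) (hM : 0 < M) (hs : 0 < s)
    (i j : Fin 2) :
    ∫ x, ‖trigPoly (block M s) (gradCoeff (stream D M s) i j) x‖ ∂torusMeasure ≤
      2 * Real.pi * D * (216 * s ^ 2 * (74 * (M * s)) ^ 2) := by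
  have hs1 : (1 : ℝ) ≤ s := by exact_mod_cast hs
  have norm_const : ‖((-(2 * Real.pi) * D : ℝ) : ℂ)‖ = 2 * Real.pi * D := by
    rw [Complex.norm_real, Real.norm_eq_abs, abs_mul, abs_neg, abs_of_pos Real.two_pi_pos,
      abs_of_nonneg hD]
  simp_rw [trigPoly_block_gradCoeff, norm_mul, norm_const]
  rw [integral_const_mul]
  refine mul_le_mul_of_nonneg_left ?_ (by positivity)
  refine (integral_mono (integrable_of_continuous (by fun_prop))
    (integrable_of_continuous (by fun_prop)) fun x => norm_sum_le _ _).trans ?_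
  rw [integral_finsetSum _ fun z _ => integrable_of_continuous (by fun_prop)]
  refine (Finset.sum_le_sum fun z hz => integral_norm_cluster_grad_le hM hz i j).trans ?_
  rw [Finset.sum_const, card_centers, nsmul_eq_mul]
  have const_le : 24 * (2 * (s : ℝ) + 1) ^ 2 ≤ 216 * s ^ 2 := by nlinarith
  calc ((6 : ℕ) : ℝ) * ((2 * (s : ℝ) + 1) ^ 2 * (4 * (74 * ((M : ℝ) * s)) ^ 2)) =
        24 * (2 * (s : ℝ) + 1) ^ 2 * (74 * ((M : ℝ) * s)) ^ 2 := by push_cast; ring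
    _ ≤ 216 * (s : ℝ) ^ 2 * (74 * ((M : ℝ) * s)) ^ 2 := by gcongr

end BlockGradient

/-! ### The sequence of scales -/

/-- Cube root of the lattice spacing of the `k`-th block. The fast growth makes the spacing of a
block exceed all frequencies of the previous ones. -/
def spacingRoot : ℕ → ℕ
  | 0 => 8
  | k + 1 => 8 * (spacingRoot k * spacingRoot k ^ (k + 3))

/-- Cube root of the cluster scale of the `k`-th block. The exponent tends to infinity in order to
reach all Sobolev exponents below `3 / 2`. -/
def scaleRoot (k : ℕ) : ℕ := spacingRoot k ^ (k + 3)

/-- Lattice spacing of the `k`-th block. -/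
def spacing (k : ℕ) : ℕ := spacingRoot k ^ 3

/-- Cluster scale of the `k`-th block. -/
def scale (k : ℕ) : ℕ := scaleRoot k ^ 3

/-- Length scale of the frequencies of the `k`-th block. -/
def freqScale (k : ℕ) : ℕ := spacing k * scale k

section Scales

variable (k : ℕ)

theorem spacingRoot_succ : spacingRoot (k + 1) = 8 * (spacingRoot k * scaleRoot k) := rfl

theorem eight_pow_le_spacingRoot : 8 ^ (k + 1) ≤ spacingRoot k := by
  induction k with
  | zero => rw [spacingRoot, zero_add, pow_one]
  | succ k ih =>
    have one_le_scaleRoot : 1 ≤ scaleRoot k :=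
      Nat.one_le_pow _ _ ((Nat.pow_pos (by norm_num)).trans_le ih)
    rw [spacingRoot_succ, pow_succ, mul_comm]
    gcongr
    exact ih.trans (Nat.le_mul_of_pos_right _ one_le_scaleRoot)

theorem spacingRoot_pos : 0 < spacingRoot k :=
  (Nat.pow_pos (by norm_num)).trans_le (eight_pow_le_spacingRoot k)

theorem scaleRoot_pos : 0 < scaleRoot k := Nat.pow_pos (spacingRoot_pos k)

theorem spacing_pos : 0 < spacing k := Nat.pow_pos (spacingRoot_pos k)

theorem scale_pos : 0 < scale k := Nat.pow_pos (scaleRoot_pos k)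

theorem freqScale_pos : 0 < freqScale k := Nat.mul_pos (spacing_pos k) (scale_pos k)

theorem cast_spacingRoot_pos : (0 : ℝ) < spacingRoot k := by exact_mod_cast spacingRoot_pos k

theorem cast_scaleRoot_pos : (0 : ℝ) < scaleRoot k := by exact_mod_cast scaleRoot_pos k

theorem one_le_cast_spacingRoot : (1 : ℝ) ≤ spacingRoot k := by exact_mod_cast spacingRoot_pos k

theorem one_le_cast_scaleRoot : (1 : ℝ) ≤ scaleRoot k := by exact_mod_cast scaleRoot_pos k

theorem spacingRoot_pow_le_scaleRoot : (spacingRoot k : ℝ) ^ 3 ≤ scaleRoot k := by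
  exact_mod_cast Nat.pow_le_pow_right (spacingRoot_pos k) (Nat.le_add_left 3 k)

theorem inv_spacingRoot_le : (spacingRoot k : ℝ)⁻¹ ≤ (1 / 4) ^ k := by
  have eight_pow_le : (8 : ℝ) ^ (k + 1) ≤ spacingRoot k := by
    exact_mod_cast eight_pow_le_spacingRoot k
  have four_pow_le : (4 : ℝ) ^ k ≤ 8 ^ (k + 1) := by
    calc (4 : ℝ) ^ k ≤ 8 ^ k := by gcongr; norm_num
      _ ≤ 8 ^ (k + 1) := by gcongr <;> norm_num
  rw [one_div, inv_pow]
  gcongr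
  exact four_pow_le.trans eight_pow_le

theorem summable_inv_spacingRoot : Summable fun k => (spacingRoot k : ℝ)⁻¹ :=
  (summable_geometric_of_lt_one (by norm_num) (by norm_num)).of_nonneg_of_le
    (fun k => by positivity) inv_spacingRoot_le

theorem spacingRoot_monotone : Monotone spacingRoot := by
  refine monotone_nat_of_le_succ fun k => ?_
  calc spacingRoot k ≤ spacingRoot k * scaleRoot k := Nat.le_mul_of_pos_right _ (scaleRoot_pos k)
    _ ≤ spacingRoot (k + 1) := by rw [spacingRoot_succ]; omega

theorem scaleRoot_monotone : Monotone scaleRoot := fun j k h =>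
  calc scaleRoot j ≤ spacingRoot k ^ (j + 3) := Nat.pow_le_pow_left (spacingRoot_monotone h) _
    _ ≤ scaleRoot k := Nat.pow_le_pow_right (spacingRoot_pos k) (by omega)

theorem exists_spacingRoot_eq_two_pow : ∃ e, spacingRoot k = 2 ^ e := by
  induction k with
  | zero => exact ⟨3, rfl⟩
  | succ k ih =>
    obtain ⟨e, he⟩ := ih
    refine ⟨3 + (e + e * (k + 3)), ?_⟩
    rw [spacingRoot_succ, scaleRoot, he, ← pow_mul, pow_add, pow_add]
    norm_num

theorem two_dvd_spacingRoot : 2 ∣ spacingRoot k := by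
  cases k with
  | zero => exact ⟨4, rfl⟩
  | succ k => exact Dvd.dvd.mul_right (by norm_num) _

variable {k}

theorem eight_mul_le_spacingRoot {j : ℕ} (h : j < k) :
    8 * (spacingRoot j * scaleRoot j) ≤ spacingRoot k := by
  rw [← spacingRoot_succ]
  exact spacingRoot_monotone h

theorem freqScale_le_spacing {j : ℕ} (h : j < k) : 512 * freqScale j ≤ spacing k :=
  calc 512 * freqScale j = (8 * (spacingRoot j * scaleRoot j)) ^ 3 := by
        rw [freqScale, spacing, scale]; ring
    _ ≤ spacingRoot k ^ 3 := Nat.pow_le_pow_left (eight_mul_le_spacingRoot h) 3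

theorem freqScale_le_freqScale {j : ℕ} (h : j < k) : 512 * freqScale j ≤ freqScale k :=
  (freqScale_le_spacing h).trans (Nat.le_mul_of_pos_right _ (scale_pos k))

end Scales

/-! ### Bounds for the blocks -/

/-- Amplitude of the `k`-th block, chosen so that the velocity has size `freqScale k ^ (-1 / 3)` in
`L³`. -/
def amplitude (k : ℕ) : ℝ := ((spacingRoot k : ℝ) ^ 4 * (scaleRoot k : ℝ) ^ 14)⁻¹

/-- Frequencies of the `k`-th block. -/
def freqs (k : ℕ) : Finset Freq := block (spacing k) (scale k)

/-- Stream coefficients of the `k`-th block. -/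
def psi (k : ℕ) : Freq → ℝ := stream (amplitude k) (spacing k) (scale k)

/-- A velocity component of the `k`-th block. -/
def vel (k : ℕ) (i : Fin 2) (x : Torus2) : ℝ := (trigPoly (freqs k) (velCoeff (psi k) i) x).re

/-- An entry of the velocity gradient of the `k`-th block. -/
def grad (k : ℕ) (i j : Fin 2) (x : Torus2) : ℝ :=
  (trigPoly (freqs k) (gradCoeff (psi k) i j) x).re

section BlockBounds

variable {k : ℕ} {α : Freq}

theorem amplitude_nonneg (k : ℕ) : 0 ≤ amplitude k := by unfold amplitude; positivity

theorem psi_neg (k : ℕ) (α : Freq) : psi k (-α) = psi k α := stream_neg _ _ _ _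

theorem psi_eq_zero (h : α ∉ freqs k) : psi k α = 0 := stream_eq_zero _ h

theorem neg_mem_freqs (h : α ∈ freqs k) : -α ∈ freqs k := neg_mem_block h

theorem abs_le_of_mem_freqs (h : α ∈ freqs k) (i : Fin 2) : |(α i : ℝ)| ≤ 74 * freqScale k := by
  exact_mod_cast abs_le_of_mem_block h i

theorem ofReal_vel (k : ℕ) (i : Fin 2) (x : Torus2) :
    (vel k i x : ℂ) = trigPoly (freqs k) (velCoeff (psi k) i) x :=
  ofReal_re_trigPoly (fun _ => neg_mem_freqs) (velCoeff_neg (psi_neg k) i) x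

theorem ofReal_grad (k : ℕ) (i j : Fin 2) (x : Torus2) :
    (grad k i j x : ℂ) = trigPoly (freqs k) (gradCoeff (psi k) i j) x :=
  ofReal_re_trigPoly (fun _ => neg_mem_freqs) (gradCoeff_neg (psi_neg k) i j) x

theorem norm_vel (k : ℕ) (i : Fin 2) (x : Torus2) :
    ‖vel k i x‖ = ‖trigPoly (freqs k) (velCoeff (psi k) i) x‖ := by
  rw [← ofReal_vel, Complex.norm_real]

theorem norm_grad (k : ℕ) (i j : Fin 2) (x : Torus2) :
    ‖grad k i j x‖ = ‖trigPoly (freqs k) (gradCoeff (psi k) i j) x‖ := by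
  rw [← ofReal_grad, Complex.norm_real]

@[fun_prop]
theorem continuous_vel (k : ℕ) (i : Fin 2) : Continuous (vel k i) :=
  Complex.continuous_re.comp (continuous_trigPoly _ _)

@[fun_prop]
theorem continuous_grad (k : ℕ) (i j : Fin 2) : Continuous (grad k i j) :=
  Complex.continuous_re.comp (continuous_trigPoly _ _)

theorem abs_psi_le (k : ℕ) (α : Freq) :
    |psi k α| ≤ 54 * ((spacingRoot k : ℝ) ^ 4 * (scaleRoot k : ℝ) ^ 8)⁻¹ := by
  refine (abs_stream_le (amplitude_nonneg k) (spacing_pos k) (scale_pos k) α).trans_eq ?_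
  have hH := (cast_spacingRoot_pos k).ne'
  have hG := (cast_scaleRoot_pos k).ne'
  rw [amplitude, scale]
  push_cast
  field_simp

theorem card_freqs_le (k : ℕ) : ((freqs k).card : ℝ) ≤ 150 * (scaleRoot k : ℝ) ^ 6 := by
  have card_le : (freqs k).card ≤ 150 * (scaleRoot k ^ 3) ^ 2 := card_block_le (scale_pos k)
  rw [← pow_mul] at card_le
  exact_mod_cast card_le

theorem norm_velCoeff_psi_le (h : α ∈ freqs k) (i : Fin 2) :
    ‖velCoeff (psi k) i α‖ ≤ 4000 * ((spacingRoot k : ℝ) * (scaleRoot k : ℝ) ^ 5)⁻¹ := by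
  refine (norm_velCoeff_le (abs_le_of_mem_freqs h) (abs_psi_le k α) i).trans ?_
  have hH := (cast_spacingRoot_pos k).ne'
  have hG := (cast_scaleRoot_pos k).ne'
  rw [freqScale, spacing, scale]
  push_cast
  field_simp
  norm_num

theorem norm_gradCoeff_psi_le (h : α ∈ freqs k) (i j : Fin 2) :
    ‖gradCoeff (psi k) i j α‖ ≤ 2 * 10 ^ 6 * ((spacingRoot k : ℝ) ^ 2 / (scaleRoot k : ℝ) ^ 2) := by
  refine (norm_gradCoeff_le (abs_le_of_mem_freqs h) (abs_psi_le k α) i j).trans ?_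
  have hH := (cast_spacingRoot_pos k).ne'
  have hG := (cast_scaleRoot_pos k).ne'
  have := Real.pi_lt_d2
  rw [freqScale, spacing, scale]
  push_cast
  field_simp
  nlinarith

theorem sum_norm_velCoeff_le (k : ℕ) (i : Fin 2) :
    ∑ α ∈ freqs k, ‖velCoeff (psi k) i α‖ ≤ 10 ^ 9 * ((scaleRoot k : ℝ) / spacingRoot k) := by
  have hH := (cast_spacingRoot_pos k).ne'
  have hG := (cast_scaleRoot_pos k).ne'
  calc ∑ α ∈ freqs k, ‖velCoeff (psi k) i α‖
      ≤ (freqs k).card • (4000 * ((spacingRoot k : ℝ) * (scaleRoot k : ℝ) ^ 5)⁻¹) :=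
        Finset.sum_le_card_nsmul _ _ _ fun α h => norm_velCoeff_psi_le h i
    _ ≤ 150 * (scaleRoot k : ℝ) ^ 6 *
          (4000 * ((spacingRoot k : ℝ) * (scaleRoot k : ℝ) ^ 5)⁻¹) := by
        rw [nsmul_eq_mul]
        gcongr
        exact card_freqs_le k
    _ ≤ 10 ^ 9 * ((scaleRoot k : ℝ) / spacingRoot k) := by field_simp; norm_num

theorem norm_vel_le (k : ℕ) (i : Fin 2) (x : Torus2) :
    ‖vel k i x‖ ≤ 10 ^ 9 * ((scaleRoot k : ℝ) / spacingRoot k) := by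
  rw [norm_vel]
  exact (norm_trigPoly_le _ _ _).trans (sum_norm_velCoeff_le k i)

theorem sum_norm_velCoeff_sq_le (k : ℕ) (i : Fin 2) :
    ∑ α ∈ freqs k, ‖velCoeff (psi k) i α‖ ^ 2 ≤
      (10 ^ 9 * ((spacingRoot k : ℝ) * (scaleRoot k : ℝ) ^ 2)⁻¹) ^ 2 := by
  have hH := (cast_spacingRoot_pos k).ne'
  have hG := (cast_scaleRoot_pos k).ne'
  calc ∑ α ∈ freqs k, ‖velCoeff (psi k) i α‖ ^ 2 ≤
        (freqs k).card • (4000 * ((spacingRoot k : ℝ) * (scaleRoot k : ℝ) ^ 5)⁻¹) ^ 2 :=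
        Finset.sum_le_card_nsmul _ _ _ fun α h =>
          pow_le_pow_left₀ (norm_nonneg _) (norm_velCoeff_psi_le h i) 2
    _ ≤ 150 * (scaleRoot k : ℝ) ^ 6 *
          (4000 * ((spacingRoot k : ℝ) * (scaleRoot k : ℝ) ^ 5)⁻¹) ^ 2 := by
        rw [nsmul_eq_mul]
        gcongr
        exact card_freqs_le k
    _ ≤ (10 ^ 9 * ((spacingRoot k : ℝ) * (scaleRoot k : ℝ) ^ 2)⁻¹) ^ 2 := by
        field_simp
        norm_num

theorem integral_norm_vel_le (k : ℕ) (i : Fin 2) :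
    ∫ x, ‖vel k i x‖ ∂torusMeasure ≤
      10 ^ 9 * ((spacingRoot k : ℝ) * (scaleRoot k : ℝ) ^ 2)⁻¹ := by
  have memLp_two : ∀ g : Torus2 → ℂ, Continuous g → MemLp g 2 torusMeasure := fun g hg =>
    hg.memLp_of_hasCompactSupport (HasCompactSupport.of_compactSpace _)
  have cauchy_schwarz := integral_norm_mul_norm_le (μ := torusMeasure)
    (memLp_two (trigPoly (freqs k) (velCoeff (psi k) i)) (by fun_prop))
    (memLp_two (fun _ => 1) (by fun_prop))
    (by positivity : 0 ≤ 10 ^ 9 * ((spacingRoot k : ℝ) * (scaleRoot k : ℝ) ^ 2)⁻¹) zero_le_one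
    (by rw [integral_norm_trigPoly_sq]; exact sum_norm_velCoeff_sq_le k i) (by simp)
  simpa only [norm_one, mul_one, ← norm_vel] using cauchy_schwarz

theorem norm_grad_le (k : ℕ) (i j : Fin 2) (x : Torus2) :
    ‖grad k i j x‖ ≤ 10 ^ 9 * ((spacingRoot k : ℝ) ^ 2 * (scaleRoot k : ℝ) ^ 4) := by
  have hH := (cast_spacingRoot_pos k).ne'
  have hG := (cast_scaleRoot_pos k).ne'
  rw [norm_grad]
  calc ‖trigPoly (freqs k) (gradCoeff (psi k) i j) x‖ ≤
        ∑ α ∈ freqs k, ‖gradCoeff (psi k) i j α‖ := norm_trigPoly_le _ _ _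
    _ ≤ (freqs k).card • (2 * 10 ^ 6 * ((spacingRoot k : ℝ) ^ 2 / (scaleRoot k : ℝ) ^ 2)) :=
        Finset.sum_le_card_nsmul _ _ _ fun α h => norm_gradCoeff_psi_le h i j
    _ ≤ 150 * (scaleRoot k : ℝ) ^ 6 *
          (2 * 10 ^ 6 * ((spacingRoot k : ℝ) ^ 2 / (scaleRoot k : ℝ) ^ 2)) := by
        rw [nsmul_eq_mul]
        gcongr
        exact card_freqs_le k
    _ ≤ 10 ^ 9 * ((spacingRoot k : ℝ) ^ 2 * (scaleRoot k : ℝ) ^ 4) := by field_simp; norm_num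

theorem integral_norm_grad_le (k : ℕ) (i j : Fin 2) :
    ∫ x, ‖grad k i j x‖ ∂torusMeasure ≤
      10 ^ 9 * ((spacingRoot k : ℝ) ^ 2 * ((scaleRoot k : ℝ) ^ 2)⁻¹) := by
  have hH := (cast_spacingRoot_pos k).ne'
  have hG := (cast_scaleRoot_pos k).ne'
  have := Real.pi_lt_d2
  simp_rw [norm_grad]
  refine (integral_norm_trigPoly_gradCoeff_stream_le (amplitude_nonneg k) (spacing_pos k)
    (scale_pos k) i j).trans ?_
  rw [amplitude, spacing, scale]
  push_cast
  field_simp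
  nlinarith

end BlockBounds

/-! ### Intermittency -/

/-- The bounds shared by the velocities and the velocity gradients of the blocks: the `k`-th field
behaves like a bump of height `10 ^ 9 * (spacingRoot k ^ 2 * scaleRoot k ^ 4)` supported on a
fraction `scaleRoot k ^ (-6)` of the torus. -/
structure IsIntermittent (f : ℕ → Torus2 → ℝ) : Prop where
  continuous : ∀ k, Continuous (f k)
  norm_le : ∀ k x, ‖f k x‖ ≤ 10 ^ 9 * ((spacingRoot k : ℝ) ^ 2 * (scaleRoot k : ℝ) ^ 4)
  integral_le : ∀ k, ∫ x, ‖f k x‖ ∂torusMeasure ≤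
    10 ^ 9 * ((spacingRoot k : ℝ) ^ 2 * ((scaleRoot k : ℝ) ^ 2)⁻¹)

theorem isIntermittent_grad (i j : Fin 2) : IsIntermittent fun k => grad k i j :=
  ⟨fun k => continuous_grad k i j, fun k => norm_grad_le k i j,
    fun k => integral_norm_grad_le k i j⟩

theorem isIntermittent_vel (i : Fin 2) : IsIntermittent fun k => vel k i := by
  refine ⟨fun k => continuous_vel k i, fun k x => (norm_vel_le k i x).trans ?_,
    fun k => (integral_norm_vel_le k i).trans ?_⟩
  · have hH := one_le_cast_spacingRoot k
    have hG := one_le_cast_scaleRoot k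
    gcongr
    calc (scaleRoot k : ℝ) / spacingRoot k ≤ scaleRoot k := div_le_self (by positivity) hH
      _ ≤ (scaleRoot k : ℝ) ^ 4 := le_self_pow₀ hG (by norm_num)
      _ ≤ _ := le_mul_of_one_le_left (by positivity) (one_le_pow₀ hH)
  · have hH := one_le_cast_spacingRoot k
    rw [mul_inv]
    gcongr
    exact (inv_le_one_of_one_le₀ hH).trans (one_le_pow₀ hH)

theorem spacingRoot_sq_div_scaleRoot_le (k : ℕ) :
    (spacingRoot k : ℝ) ^ 2 / scaleRoot k ≤ (spacingRoot k : ℝ)⁻¹ := by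
  rw [div_le_iff₀ (cast_scaleRoot_pos k), inv_mul_eq_div, le_div_iff₀ (cast_spacingRoot_pos k),
    ← pow_succ]
  exact spacingRoot_pow_le_scaleRoot k

-- Below the exponent `3 / 2` the power of `scaleRoot k` is negative, and `scaleRoot k` grows
-- faster than any power of `spacingRoot k`.
theorem summable_spacingRoot_sq_mul_scaleRoot_rpow {p : ℝ} (hp : 0 < p) (hp' : p < 3 / 2) :
    Summable fun k => (spacingRoot k : ℝ) ^ 2 * (scaleRoot k : ℝ) ^ (4 - 6 / p) := by
  have gap_pos : 0 < 6 / p - 4 := by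
    rw [sub_pos, lt_div_iff₀ hp]
    linarith
  refine Summable.of_norm_bounded_eventually_nat summable_inv_spacingRoot ?_
  obtain ⟨N, hN⟩ := exists_nat_gt (3 / (6 / p - 4))
  filter_upwards [eventually_ge_atTop N] with k hk
  have hH := cast_spacingRoot_pos k
  have scaleRoot_eq : (scaleRoot k : ℝ) = (spacingRoot k : ℝ) ^ ((k : ℝ) + 3) := by
    rw [scaleRoot]
    norm_cast
  have exponent_le : 2 + ((k : ℝ) + 3) * (4 - 6 / p) ≤ -1 := by
    have hNk : (N : ℝ) ≤ k := by exact_mod_cast hk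
    rw [div_lt_iff₀ gap_pos] at hN
    nlinarith
  rw [Real.norm_of_nonneg (by positivity), scaleRoot_eq, ← Real.rpow_two, ← Real.rpow_mul hH.le,
    ← Real.rpow_add hH, ← Real.rpow_neg_one]
  exact Real.rpow_le_rpow_of_exponent_le (one_le_cast_spacingRoot k) exponent_le

namespace IsIntermittent

variable {f : ℕ → Torus2 → ℝ} (hf : IsIntermittent f)
include hf

theorem integrable (k : ℕ) : Integrable (f k) torusMeasure :=
  integrable_of_continuous (hf.continuous k)

theorem summable : Summable fun k => ∫ x, ‖f k x‖ ∂torusMeasure := by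
  refine (summable_inv_spacingRoot.mul_left (10 ^ 9)).of_nonneg_of_le
    (fun k => integral_nonneg fun _ => norm_nonneg _) fun k => (hf.integral_le k).trans ?_
  gcongr
  rw [← div_eq_mul_inv]
  refine le_trans ?_ (spacingRoot_sq_div_scaleRoot_le k)
  have hG := one_le_cast_scaleRoot k
  gcongr
  exact le_self_pow₀ hG two_ne_zero

theorem eLpNorm_le {p : ℝ} (hp : 1 ≤ p) (k : ℕ) :
    eLpNorm (f k) (ENNReal.ofReal p) torusMeasure ≤ ENNReal.ofReal
      (10 ^ 9 * ((spacingRoot k : ℝ) ^ 2 * (scaleRoot k : ℝ) ^ (4 - 6 / p))) := by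
  have hG := cast_scaleRoot_pos k
  have integral_rpow_le : ∫ x, ‖f k x‖ ^ (1 : ℝ) ∂torusMeasure ≤
      (10 ^ 9 * ((spacingRoot k : ℝ) ^ 2 * (scaleRoot k : ℝ) ^ 4)) ^ (1 : ℝ) *
        ((scaleRoot k : ℝ) ^ 6)⁻¹ := by
    simp_rw [Real.rpow_one]
    refine (hf.integral_le k).trans_eq ?_
    field_simp
  refine (eLpNorm_le_of_norm_le_of_integral_rpow_le one_pos hp (by positivity) (by positivity)
    (hf.norm_le k) (by simpa using (hf.integrable k).norm) integral_rpow_le).trans_eq ?_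
  congr 1
  rw [sub_eq_add_neg, Real.rpow_add hG, show -(6 / p) = -6 * (1 / p) by ring,
    Real.rpow_mul hG.le, Real.rpow_neg hG.le, mul_assoc, mul_assoc]
  norm_cast

theorem memLp {p : ℝ≥0∞} (hp : 1 ≤ p) (hp' : p < 3 / 2) :
    MemLp (fun x => ∑' k, f k x) p torusMeasure := by
  refine memLp_tsum hp (fun k => (hf.integrable k).1) ?_
  obtain ⟨r, rfl⟩ : ∃ r : ℝ, p = ENNReal.ofReal r :=
    ⟨p.toReal, (ENNReal.ofReal_toReal (hp'.trans_le le_top).ne).symm⟩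
  have hr : 1 ≤ r := by simpa using hp
  have hr' : r < 3 / 2 := by
    rw [← ENNReal.ofReal_lt_ofReal_iff (by norm_num), ENNReal.ofReal_div_of_pos two_pos]
    simpa using hp'
  refine ne_top_of_le_ne_top ?_ (ENNReal.tsum_le_tsum fun k => hf.eLpNorm_le hr k)
  exact ((summable_spacingRoot_sq_mul_scaleRoot_rpow (one_pos.trans_le hr) hr').mul_left
    _).tsum_ofReal_ne_top

end IsIntermittent

section Products

variable {k l : ℕ} (i i' j : Fin 2)

theorem integral_norm_vel_mul_grad_le_of_le (h : k ≤ l) :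
    ∫ x, ‖vel k j x * grad l i i' x‖ ∂torusMeasure ≤ 10 ^ 18 * (spacingRoot l : ℝ)⁻¹ := by
  have hG := (cast_scaleRoot_pos l).ne'
  have vel_le : ∀ x, ‖vel k j x‖ ≤ 10 ^ 9 * (scaleRoot l : ℝ) := fun x => by
    refine (norm_vel_le k j x).trans ?_
    gcongr
    exact (div_le_self (cast_scaleRoot_pos k).le (one_le_cast_spacingRoot k)).trans
      (by exact_mod_cast scaleRoot_monotone h)
  calc ∫ x, ‖vel k j x * grad l i i' x‖ ∂torusMeasure
      ≤ 10 ^ 9 * (scaleRoot l : ℝ) *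
          (10 ^ 9 * ((spacingRoot l : ℝ) ^ 2 * ((scaleRoot l : ℝ) ^ 2)⁻¹)) := by
        refine (integral_norm_mul_le_of_norm_le vel_le
          ((isIntermittent_grad i i').integrable l)).trans ?_
        gcongr
        exact integral_norm_grad_le l i i'
    _ = 10 ^ 18 * ((spacingRoot l : ℝ) ^ 2 / scaleRoot l) := by field_simp
    _ ≤ 10 ^ 18 * (spacingRoot l : ℝ)⁻¹ := by
        gcongr
        exact spacingRoot_sq_div_scaleRoot_le l

theorem integral_norm_vel_mul_grad_le_of_lt (h : l < k) :
    ∫ x, ‖vel k j x * grad l i i' x‖ ∂torusMeasure ≤ 10 ^ 18 * (spacingRoot k : ℝ)⁻¹ := by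
  have hH := one_le_cast_spacingRoot k
  have hG := cast_scaleRoot_pos k
  have mul_le : (spacingRoot l : ℝ) * scaleRoot l ≤ spacingRoot k := by
    exact_mod_cast (Nat.le_mul_of_pos_left _ (by norm_num : 0 < 8)).trans
      (eight_mul_le_spacingRoot h)
  have grad_le : ∀ x, ‖grad l i i' x‖ ≤ 10 ^ 9 * (spacingRoot k : ℝ) ^ 4 := fun x => by
    refine (norm_grad_le l i i' x).trans ?_
    gcongr
    calc (spacingRoot l : ℝ) ^ 2 * (scaleRoot l : ℝ) ^ 4
        ≤ (spacingRoot l : ℝ) ^ 4 * (scaleRoot l : ℝ) ^ 4 := by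
          gcongr
          · exact one_le_cast_spacingRoot l
          · norm_num
      _ = ((spacingRoot l : ℝ) * scaleRoot l) ^ 4 := (mul_pow _ _ _).symm
      _ ≤ _ := by gcongr
  calc ∫ x, ‖vel k j x * grad l i i' x‖ ∂torusMeasure
      ≤ 10 ^ 9 * (spacingRoot k : ℝ) ^ 4 *
          (10 ^ 9 * ((spacingRoot k : ℝ) * (scaleRoot k : ℝ) ^ 2)⁻¹) := by
        simp_rw [mul_comm (vel k j _)]
        refine (integral_norm_mul_le_of_norm_le grad_le
          ((isIntermittent_vel j).integrable k)).trans ?_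
        gcongr
        exact integral_norm_vel_le k j
    _ = 10 ^ 18 * ((spacingRoot k : ℝ) ^ 4 / (scaleRoot k : ℝ) ^ 2 * (spacingRoot k : ℝ)⁻¹) := by
        field_simp
    _ ≤ 10 ^ 18 * (spacingRoot k : ℝ)⁻¹ := by
        have ratio_le_one : (spacingRoot k : ℝ) ^ 4 / (scaleRoot k : ℝ) ^ 2 ≤ 1 := by
          rw [div_le_one₀ (by positivity)]
          calc (spacingRoot k : ℝ) ^ 4 ≤ ((spacingRoot k : ℝ) ^ 3) ^ 2 := by
                rw [← pow_mul]
                exact pow_le_pow_right₀ hH (by norm_num)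
            _ ≤ _ := pow_le_pow_left₀ (by positivity) (spacingRoot_pow_le_scaleRoot k) 2
        gcongr
        exact mul_le_of_le_one_left (by positivity) ratio_le_one

theorem summable_vel_mul_grad :
    Summable fun p : ℕ × ℕ => ∫ x, ‖vel p.1 j x * grad p.2 i i' x‖ ∂torusMeasure := by
  have inv_le : ∀ {m n : ℕ}, n ≤ m →
      (spacingRoot m : ℝ)⁻¹ ≤ (1 / 2 : ℝ) ^ m * (1 / 2) ^ n := fun {m n} h =>
    calc (spacingRoot m : ℝ)⁻¹ ≤ (1 / 2) ^ m * (1 / 2) ^ m := by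
          rw [← mul_pow]
          exact (inv_spacingRoot_le m).trans_eq (by norm_num)
      _ ≤ _ := by
          gcongr ?_ * ?_
          exact pow_le_pow_of_le_one (by norm_num) (by norm_num) h
  have geometric : Summable fun n : ℕ => (1 / 2 : ℝ) ^ n :=
    summable_geometric_of_lt_one (by norm_num) (by norm_num)
  refine ((geometric.mul_of_nonneg geometric (fun n => by positivity)
    fun n => by positivity).mul_left (10 ^ 18)).of_nonneg_of_le
    (fun p => integral_nonneg fun _ => norm_nonneg _) fun ⟨k, l⟩ => ?_
  rcases le_or_gt k l with h | h
  · refine (integral_norm_vel_mul_grad_le_of_le i i' j h).trans ?_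
    rw [mul_comm ((1 / 2 : ℝ) ^ k)]
    gcongr
    exact inv_le h
  · refine (integral_norm_vel_mul_grad_le_of_lt i i' j h).trans ?_
    gcongr
    exact inv_le h.le

end Products

/-! ### The flow and its weak gradient -/

section WeakDerivatives

theorem integral_trigPoly_mul_torusPartial {φ : Torus2 → ℝ} (hφ : IsTestFunction φ) (j : Fin 2)
    (s : Finset Freq) (c : Freq → ℂ) :
    ∫ x, trigPoly s c x * (torusPartial j φ x : ℂ) ∂torusMeasure =
      -∫ x, trigPoly s (fun α => 2 * Real.pi * Complex.I * α j * c α) x * (φ x : ℂ)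
        ∂torusMeasure := by
  have integral_mul : ∀ (d : Freq → ℂ) {ψ : Torus2 → ℝ}, Continuous ψ →
      ∫ x, trigPoly s d x * (ψ x : ℂ) ∂torusMeasure =
        ∑ α ∈ s, d α * ∫ x, mFourier α x * (ψ x : ℂ) ∂torusMeasure := fun d ψ hψ => by
    simp_rw [trigPoly, Finset.sum_mul, mul_assoc]
    rw [integral_finsetSum _ fun α _ => integrable_of_continuous (by fun_prop)]
    simp_rw [integral_const_mul]
  rw [integral_mul _ (continuous_torusPartial hφ j),
    integral_mul _ (continuous_of_isTestFunction hφ), ← Finset.sum_neg_distrib]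
  refine Finset.sum_congr rfl fun α _ => ?_
  simp_rw [integral_mFourier_mul_torusPartial hφ, mul_assoc _ (mFourier α _), integral_const_mul]
  ring

theorem integral_tsum_mul_torusPartial {f g : ℕ → Torus2 → ℝ} {j : Fin 2}
    (hf : ∀ k, Integrable (f k) torusMeasure)
    (hfs : Summable fun k => ∫ x, ‖f k x‖ ∂torusMeasure)
    (hg : ∀ k, Integrable (g k) torusMeasure)
    (hgs : Summable fun k => ∫ x, ‖g k x‖ ∂torusMeasure)
    {φ : Torus2 → ℝ} (hφ : IsTestFunction φ)
    (hfg : ∀ k, ∫ x, f k x * torusPartial j φ x ∂torusMeasure =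
      -∫ x, g k x * φ x ∂torusMeasure) :
    ∫ x, (∑' k, f k x) * torusPartial j φ x ∂torusMeasure =
      -∫ x, (∑' k, g k x) * φ x ∂torusMeasure := by
  have hφc := continuous_of_isTestFunction hφ
  have hφ'c := continuous_torusPartial hφ j
  obtain ⟨C, hC⟩ := (HasCompactSupport.of_compactSpace φ).exists_bound_of_continuous hφc
  obtain ⟨C', hC'⟩ := (HasCompactSupport.of_compactSpace _).exists_bound_of_continuous hφ'c
  have hasSum_left := hasSum_integral_smul_of_bounded hf hfs hφ'c.aestronglyMeasurable hC'
  have hasSum_right := hasSum_integral_smul_of_bounded hg hgs hφc.aestronglyMeasurable hC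
  simp only [smul_eq_mul, hfg] at hasSum_left hasSum_right
  exact hasSum_left.unique hasSum_right.neg

theorem isDivergenceFree_of_hasWeakGradient {u : Torus2 → Plane}
    {G : Torus2 → Matrix (Fin 2) (Fin 2) ℝ} (h : HasWeakGradient u G)
    (hG : ∀ x, (G x).trace = 0) : IsDivergenceFree u := by
  refine ⟨h.1, fun φ hφ => ?_⟩
  have integrable_mul : ∀ {f ψ : Torus2 → ℝ}, Integrable f torusMeasure → Continuous ψ →
      Integrable (fun x => f x * ψ x) torusMeasure := fun {f ψ} hf hψ => by
    obtain ⟨C, hC⟩ := (HasCompactSupport.of_compactSpace ψ).exists_bound_of_continuous hψ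
    exact hf.mul_bdd hψ.aestronglyMeasurable (ae_of_all _ hC)
  calc ∫ x, ∑ j, u x j * torusPartial j φ x ∂torusMeasure
      = ∑ j, -∫ x, G x j j * φ x ∂torusMeasure := by
        rw [integral_finsetSum _ fun j _ => integrable_mul (h.1 j) (continuous_torusPartial hφ j)]
        exact Finset.sum_congr rfl fun j _ => h.2.2 j j φ hφ
    _ = -∫ x, (G x).trace * φ x ∂torusMeasure := by
        rw [Finset.sum_neg_distrib, ← integral_finsetSum _ fun j _ =>
          integrable_mul (h.2.1 j j) (continuous_of_isTestFunction hφ)]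
        simp only [Matrix.trace, Matrix.diag, Finset.sum_mul]
    _ = 0 := by simp [hG]

end WeakDerivatives

/-- The intermittent flow: the sum of all blocks. -/
def flow (x : Torus2) : Plane := WithLp.toLp 2 fun i => ∑' k, vel k i x

/-- The gradient of the intermittent flow. -/
def flowGrad (x : Torus2) : Matrix (Fin 2) (Fin 2) ℝ := Matrix.of fun i j => ∑' k, grad k i j x

theorem integrable_flow (i : Fin 2) : Integrable (fun x => flow x i) torusMeasure :=
  integrable_tsum (isIntermittent_vel i).integrable (isIntermittent_vel i).summable

theorem integrable_flowGrad (i j : Fin 2) : Integrable (fun x => flowGrad x i j) torusMeasure :=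
  integrable_tsum (isIntermittent_grad i j).integrable (isIntermittent_grad i j).summable

theorem integral_vel_mul_torusPartial {φ : Torus2 → ℝ} (hφ : IsTestFunction φ) (k : ℕ)
    (i j : Fin 2) :
    ∫ x, vel k i x * torusPartial j φ x ∂torusMeasure =
      -∫ x, grad k i j x * φ x ∂torusMeasure := by
  have complex_identity := integral_trigPoly_mul_torusPartial hφ j (freqs k) (velCoeff (psi k) i)
  rw [← Complex.ofReal_inj, Complex.ofReal_neg, ← integral_complex_ofReal,
    ← integral_complex_ofReal]
  simp_rw [Complex.ofReal_mul, ofReal_vel, ofReal_grad]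
  exact complex_identity

theorem hasWeakGradient_flow : HasWeakGradient flow flowGrad :=
  ⟨integrable_flow, integrable_flowGrad, fun i j _ hφ =>
    integral_tsum_mul_torusPartial (isIntermittent_vel i).integrable
      (isIntermittent_vel i).summable (isIntermittent_grad i j).integrable
      (isIntermittent_grad i j).summable hφ fun k => integral_vel_mul_torusPartial hφ k i j⟩

theorem trace_flowGrad (x : Torus2) : (flowGrad x).trace = 0 := by
  have grad_one_one : ∀ k, grad k 1 1 x = -grad k 0 0 x := fun k => by
    have coeff_eq : ∀ α, gradCoeff (psi k) 1 1 α = -gradCoeff (psi k) 0 0 α := fun α =>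
      eq_neg_of_add_eq_zero_right (by simpa using sum_gradCoeff_diag (psi k) α)
    simp [grad, trigPoly, coeff_eq]
  simp [Matrix.trace_fin_two, flowGrad, grad_one_one, tsum_neg]

theorem isDivergenceFree_flow : IsDivergenceFree flow :=
  isDivergenceFree_of_hasWeakGradient hasWeakGradient_flow trace_flowGrad

theorem memSobolevOne_flow {p : ℝ≥0∞} (hp : 1 ≤ p) (hp' : p < 3 / 2) : MemSobolevOne p flow :=
  ⟨fun i => (isIntermittent_vel i).memLp hp hp', flowGrad, hasWeakGradient_flow,
    fun i j => (isIntermittent_grad i j).memLp hp hp'⟩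

/-! ### Fourier coefficients of the flow -/

section FourierCoefficients

variable {k : ℕ} {α : Freq}

theorem velCoeff_psi_eq_zero (h : α ∉ freqs k) (i : Fin 2) : velCoeff (psi k) i α = 0 :=
  velCoeff_eq_zero (psi_eq_zero h) i

theorem hasSum_mFourierCoeff_flow (i : Fin 2) (α : Freq) :
    HasSum (fun k => velCoeff (psi k) i α) (mFourierCoeff (fun y => (flow y i : ℂ)) α) := by
  have hasSum_integral := hasSum_integral_smul_of_bounded (isIntermittent_vel i).integrable
    (isIntermittent_vel i).summable (w := fun x => mFourier (-α) x)
    (by fun_prop) fun x => (norm_mFourier_apply (-α) x).le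
  have integral_vel : ∀ k, ∫ x, vel k i x • mFourier (-α) x ∂torusMeasure =
      velCoeff (psi k) i α := fun k => by
    simp_rw [Complex.real_smul, ofReal_vel, mul_comm _ (mFourier (-α) _),
      integral_mFourier_mul_trigPoly, neg_neg]
    exact ite_eq_left_iff.2 fun h => (velCoeff_psi_eq_zero h i).symm
  have mFourierCoeff_eq : mFourierCoeff (fun y => (flow y i : ℂ)) α =
      ∫ x, (∑' k, vel k i x) • mFourier (-α) x ∂torusMeasure :=
    integral_congr_ae <| ae_of_all _ fun x => by
      simp only [flow, Complex.real_smul, smul_eq_mul, mul_comm]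
  simpa only [integral_vel, mFourierCoeff_eq] using hasSum_integral

theorem abs_le_norm_freq (α : Freq) (i : Fin 2) : |(α i : ℝ)| ≤ ‖freq α‖ :=
  PiLp.norm_apply_le (freq α) i

theorem norm_freq_le (α : Freq) : ‖freq α‖ ≤ |(α 0 : ℝ)| + |(α 1 : ℝ)| := by
  rw [EuclideanSpace.norm_eq, Real.sqrt_le_left (by positivity)]
  simp only [freq, Fin.sum_univ_two, Real.norm_eq_abs]
  nlinarith [abs_nonneg (α 0 : ℝ), abs_nonneg (α 1 : ℝ)]

theorem norm_freq_le_of_mem (h : α ∈ freqs k) : ‖freq α‖ ≤ 148 * freqScale k := by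
  linarith [norm_freq_le α, abs_le_of_mem_freqs h 0, abs_le_of_mem_freqs h 1]

theorem le_norm_freq_of_mem (h : α ∈ freqs k) : 22 * freqScale k ≤ ‖freq α‖ := by
  have le_abs : (22 : ℝ) * freqScale k ≤ |(α 0 : ℝ)| := by exact_mod_cast le_abs_of_mem_block h
  exact le_abs.trans (abs_le_norm_freq α 0)

theorem eq_of_freqScale_le {j k : ℕ} (hjk : (freqScale j : ℝ) ≤ 27 * freqScale k)
    (hkj : (freqScale k : ℝ) ≤ 27 * freqScale j) : j = k := by
  have le_of_lt : ∀ {i l : ℕ}, i < l → (512 : ℝ) * freqScale i ≤ freqScale l := fun h => by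
    exact_mod_cast freqScale_le_freqScale h
  have hj : (0 : ℝ) < freqScale j := by exact_mod_cast freqScale_pos j
  have hk : (0 : ℝ) < freqScale k := by exact_mod_cast freqScale_pos k
  rcases lt_trichotomy j k with h | h | h
  · linarith [le_of_lt h]
  · exact h
  · linarith [le_of_lt h]

theorem eq_of_mem_freqs {j : ℕ} (hj : α ∈ freqs j) (hk : α ∈ freqs k) : j = k :=
  eq_of_freqScale_le (by linarith [le_norm_freq_of_mem hj, norm_freq_le_of_mem hk])
    (by linarith [le_norm_freq_of_mem hk, norm_freq_le_of_mem hj])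

theorem mFourierCoeff_flow_of_mem (h : α ∈ freqs k) (i : Fin 2) :
    mFourierCoeff (fun y => (flow y i : ℂ)) α = velCoeff (psi k) i α :=
  (hasSum_mFourierCoeff_flow i α).unique <| hasSum_single k fun _ hl =>
    velCoeff_psi_eq_zero (fun hm => hl (eq_of_mem_freqs hm h)) i

theorem mFourierCoeff_flow_of_notMem (h : ∀ k, α ∉ freqs k) (i : Fin 2) :
    mFourierCoeff (fun y => (flow y i : ℂ)) α = 0 := by
  have hasSum_zero' := hasSum_mFourierCoeff_flow i α
  simp only [fun k => velCoeff_psi_eq_zero (h k) i] at hasSum_zero'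
  exact hasSum_zero'.unique hasSum_zero

end FourierCoefficients

/-! ### Besov regularity -/

/-- Cut-off functions without any regularity: `χ` is bounded and even, equals `1` where
`|ξ| ≤ 1/2`, and vanishes outside the closed unit ball. Evenness makes the truncations of real
functions real. -/
structure IsRoughCutoff (χ : Plane → ℝ) : Prop where
  bounded : ∃ C, ∀ ξ, |χ ξ| ≤ C
  even : ∀ ξ, χ (-ξ) = χ ξ
  eq_one : ∀ ξ : Plane, ‖ξ‖ ≤ 1 / 2 → χ ξ = 1
  eq_zero : ∀ ξ : Plane, 1 < ‖ξ‖ → χ ξ = 0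

theorem IsCutoff.isRoughCutoff {χ : Plane → ℝ} (hχ : IsCutoff χ) : IsRoughCutoff χ where
  bounded := by
    have hasCompactSupport : HasCompactSupport χ :=
      (isCompact_closedBall (0 : Plane) 1).of_isClosed_subset (isClosed_tsupport χ)
        hχ.support_subset
    simpa only [Real.norm_eq_abs] using
      hasCompactSupport.exists_bound_of_continuous hχ.smooth.continuous
  even ξ := hχ.radial _ _ (norm_neg ξ)
  eq_one := hχ.eq_one
  eq_zero _ hξ := image_eq_zero_of_notMem_tsupport fun hmem =>
    hξ.not_ge (mem_closedBall_zero_iff.1 (hχ.support_subset hmem))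

/-- The Fourier symbol of `dyadicMultiplier m q`. -/
def symbol (m : Plane → ℝ) (q : ℕ) (α : Freq) : ℝ := m (((2 : ℝ) ^ q)⁻¹ • freq α)

theorem norm_inv_two_pow_smul_freq (q : ℕ) (α : Freq) :
    ‖((2 : ℝ) ^ q)⁻¹ • freq α‖ = ‖freq α‖ / 2 ^ q := by
  rw [norm_smul, norm_inv, norm_pow, Real.norm_ofNat, inv_mul_eq_div]

theorem dyadicMultiplier_eq_trigPoly {m : Plane → ℝ} {q : ℕ} {f : Torus2 → ℝ} {s : Finset Freq}
    (hs : ∀ α ∉ s, symbol m q α = 0 ∨ mFourierCoeff (fun y => (f y : ℂ)) α = 0) :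
    dyadicMultiplier m q f =
      trigPoly s fun α => (symbol m q α : ℂ) * mFourierCoeff (fun y => (f y : ℂ)) α := by
  funext x
  exact tsum_eq_sum fun α hα => mul_eq_zero_of_left
    (mul_eq_zero.2 ((hs α hα).imp_left Complex.ofReal_eq_zero.2)) _

theorem dyadicMultiplier_flow {m : Plane → ℝ} {q : ℕ} {J : Finset ℕ}
    (hJ : ∀ k ∉ J, ∀ α ∈ freqs k, symbol m q α = 0) (i : Fin 2) :
    dyadicMultiplier m q (fun x => flow x i) = fun x =>
      ∑ k ∈ J, trigPoly (freqs k) (fun α => (symbol m q α : ℂ) * velCoeff (psi k) i α) x := by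
  have disjoint : (J : Set ℕ).PairwiseDisjoint freqs := fun j _ k _ hjk =>
    Finset.disjoint_left.2 fun _ hj hk => hjk (eq_of_mem_freqs hj hk)
  rw [dyadicMultiplier_eq_trigPoly (s := J.biUnion freqs)]
  · funext x
    rw [trigPoly, Finset.sum_biUnion disjoint]
    exact Finset.sum_congr rfl fun k _ => Finset.sum_congr rfl fun α hα => by
      rw [mFourierCoeff_flow_of_mem hα]
  intro α hα
  simp only [Finset.mem_biUnion, not_exists, not_and] at hα
  by_cases hmem : ∃ k, α ∈ freqs k
  · obtain ⟨k, hk⟩ := hmem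
    exact .inl (hJ k (fun h => hα k h hk) α hk)
  · exact .inr (mFourierCoeff_flow_of_notMem (not_exists.1 hmem) i)

section Besov

variable {χ : Plane → ℝ}

theorem norm_mem_Ioc_of_shell_ne_zero (hχ : IsRoughCutoff χ) {ξ : Plane} (h : shell χ ξ ≠ 0) :
    ‖ξ‖ ∈ Set.Ioc (1 / 2) 2 := by
  have norm_half : ‖(2 : ℝ)⁻¹ • ξ‖ = ‖ξ‖ / 2 := by
    rw [norm_smul, norm_inv, Real.norm_ofNat, inv_mul_eq_div]
  contrapose! h
  rw [Set.mem_Ioc, not_and_or, not_lt, not_le] at h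
  rcases h with h | h
  · rw [shell, hχ.eq_one ξ h, hχ.eq_one _ (by linarith [norm_nonneg ξ]), sub_self]
  · rw [shell, hχ.eq_zero ξ (by linarith), hχ.eq_zero _ (by linarith), sub_self]

theorem two_pow_mem_Icc_of_shell_ne_zero (hχ : IsRoughCutoff χ) {q k : ℕ} {α : Freq}
    (hα : α ∈ freqs k) (h : symbol (shell χ) q α ≠ 0) :
    (2 : ℝ) ^ q ∈ Set.Icc (11 * freqScale k : ℝ) (296 * freqScale k) := by
  have norm_mem := norm_mem_Ioc_of_shell_ne_zero hχ h
  have two_pow_pos : (0 : ℝ) < 2 ^ q := by positivity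
  rw [norm_inv_two_pow_smul_freq, Set.mem_Ioc, lt_div_iff₀ two_pow_pos,
    div_le_iff₀ two_pow_pos] at norm_mem
  constructor <;> linarith [norm_freq_le_of_mem hα, le_norm_freq_of_mem hα]

theorem lpComponent_flow (hχ : IsRoughCutoff χ) {q k : ℕ} {α : Freq}
    (hα : α ∈ freqs k) (h : symbol (shell χ) q α ≠ 0) (i : Fin 2) :
    lpComponent χ q (fun x => flow x i) = trigPoly (freqs k) fun β =>
      (symbol (shell χ) q β : ℂ) * velCoeff (psi k) i β := by
  rw [lpComponent, dyadicMultiplier_flow (J := {k})]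
  · simp only [Finset.sum_singleton]
  intro l hlk β hβ
  by_contra hne
  have mem_k := two_pow_mem_Icc_of_shell_ne_zero hχ hα h
  have mem_l := two_pow_mem_Icc_of_shell_ne_zero hχ hβ hne
  exact hlk <| Finset.mem_singleton.2 <| eq_of_freqScale_le (by linarith [mem_l.1, mem_k.2])
    (by linarith [mem_k.1, mem_l.2])

theorem norm_trigPoly_le_of_norm_le {s : Finset Freq} {c d : Freq → ℂ} {C : ℝ}
    (h : ∀ α ∈ s, ‖d α‖ ≤ C * ‖c α‖) (x : Torus2) :
    ‖trigPoly s d x‖ ≤ C * ∑ α ∈ s, ‖c α‖ := by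
  rw [Finset.mul_sum]
  exact (norm_trigPoly_le _ _ _).trans (Finset.sum_le_sum h)

theorem integral_norm_trigPoly_sq_le_of_norm_le {s : Finset Freq} {c d : Freq → ℂ} {C : ℝ}
    (h : ∀ α ∈ s, ‖d α‖ ≤ C * ‖c α‖) :
    ∫ x, ‖trigPoly s d x‖ ^ 2 ∂torusMeasure ≤ C ^ 2 * ∑ α ∈ s, ‖c α‖ ^ 2 := by
  rw [integral_norm_trigPoly_sq, Finset.mul_sum]
  refine Finset.sum_le_sum fun α hα => ?_
  rw [← mul_pow]
  exact pow_le_pow_left₀ (norm_nonneg _) (h α hα) 2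

theorem eLpNorm_three_trigPoly_le {k : ℕ} {i : Fin 2} {c : Freq → ℂ} {C : ℝ} (hC : 0 ≤ C)
    (hc : ∀ α ∈ freqs k, ‖c α‖ ≤ C * ‖velCoeff (psi k) i α‖) :
    eLpNorm (trigPoly (freqs k) c) 3 torusMeasure ≤
      ENNReal.ofReal (C * 10 ^ 9 * ((spacingRoot k : ℝ) * scaleRoot k)⁻¹) := by
  have hH := (cast_spacingRoot_pos k).ne'
  have hG := (cast_scaleRoot_pos k).ne'
  have norm_le : ∀ x, ‖trigPoly (freqs k) c x‖ ≤
      C * 10 ^ 9 * ((scaleRoot k : ℝ) / spacingRoot k) := fun x =>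
    (norm_trigPoly_le_of_norm_le hc x).trans <| by
      rw [mul_assoc]
      exact mul_le_mul_of_nonneg_left (sum_norm_velCoeff_le k i) hC
  have integral_le : ∫ x, ‖trigPoly (freqs k) c x‖ ^ (2 : ℝ) ∂torusMeasure ≤
      (C * 10 ^ 9 * ((scaleRoot k : ℝ) / spacingRoot k)) ^ (2 : ℝ) *
        (((scaleRoot k : ℝ) ^ 2)⁻¹) ^ (3 : ℝ) := by
    simp only [Real.rpow_ofNat]
    calc ∫ x, ‖trigPoly (freqs k) c x‖ ^ 2 ∂torusMeasure
        ≤ C ^ 2 * (10 ^ 9 * ((spacingRoot k : ℝ) * (scaleRoot k : ℝ) ^ 2)⁻¹) ^ 2 :=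
          (integral_norm_trigPoly_sq_le_of_norm_le hc).trans <|
            mul_le_mul_of_nonneg_left (sum_norm_velCoeff_sq_le k i) (sq_nonneg C)
      _ = _ := by field_simp
  have interpolated := eLpNorm_le_of_norm_le_of_integral_rpow_le (p := 3) (by norm_num)
    (by norm_num) (by positivity) (by positivity) norm_le
    (integrable_of_continuous (by simp only [Real.rpow_two]; fun_prop)) integral_le
  rw [ENNReal.ofReal_ofNat, one_div, Real.rpow_rpow_inv (by positivity) (by norm_num)]
    at interpolated
  refine interpolated.trans (ENNReal.ofReal_le_ofReal (le_of_eq ?_))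
  field_simp

theorem two_pow_rpow_le_of_le {q k : ℕ} (h : (2 : ℝ) ^ q ≤ 296 * freqScale k) :
    ((2 : ℝ) ^ q) ^ (1 / 3 : ℝ) ≤ 7 * ((spacingRoot k : ℝ) * scaleRoot k) := by
  rw [one_div, Real.rpow_inv_le_iff_of_pos (by positivity) (by positivity) (by norm_num)]
  refine h.trans ?_
  rw [freqScale, spacing, scale]
  norm_cast
  ring_nf
  gcongr
  norm_num

theorem memBesovTop_flow (hχ : IsRoughCutoff χ) : MemBesovTop χ (1 / 3) 3 flow := by
  obtain ⟨K, hK⟩ := hχ.bounded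
  have hK0 : 0 ≤ K := (abs_nonneg _).trans (hK 0)
  have abs_shell_le : ∀ ξ, |shell χ ξ| ≤ 2 * K := fun ξ =>
    (abs_sub _ _).trans (by linarith [hK ((2 : ℝ)⁻¹ • ξ), hK ξ])
  refine fun i => ⟨integrable_flow i, (7 * (2 * K * 10 ^ 9)).toNNReal, fun q => ?_⟩
  by_cases hex : ∃ k, ∃ α ∈ freqs k, symbol (shell χ) q α ≠ 0
  · obtain ⟨k, α, hα, hne⟩ := hex
    have hH := (cast_spacingRoot_pos k).ne'
    have hG := (cast_scaleRoot_pos k).ne'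
    rw [lpComponent_flow hχ hα hne]
    calc _ ≤ ENNReal.ofReal (7 * ((spacingRoot k : ℝ) * scaleRoot k)) *
          ENNReal.ofReal (2 * K * 10 ^ 9 * ((spacingRoot k : ℝ) * scaleRoot k)⁻¹) := by
          gcongr
          · exact two_pow_rpow_le_of_le (two_pow_mem_Icc_of_shell_ne_zero hχ hα hne).2
          · refine eLpNorm_three_trigPoly_le (i := i) (by positivity) fun β _ => ?_
            rw [norm_mul, Complex.norm_real]
            gcongr
            exact abs_shell_le _
      _ = ENNReal.ofReal (7 * (2 * K * 10 ^ 9)) := by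
          rw [← ENNReal.ofReal_mul (by positivity)]
          field_simp
  · push Not at hex
    have lpComponent_eq_zero : lpComponent χ q (fun x => flow x i) = 0 := by
      rw [lpComponent, dyadicMultiplier_flow (J := ∅) fun k _ => hex k]
      simp only [Finset.sum_empty, Pi.zero_def]
    rw [lpComponent_eq_zero, eLpNorm_zero, mul_zero]
    exact zero_le

end Besov

/-! ### Advection -/

section Advection

theorem integrable_vel_mul_grad (i i' j : Fin 2) (p : ℕ × ℕ) :
    Integrable (fun x => vel p.1 j x * grad p.2 i i' x) torusMeasure :=
  integrable_of_continuous (by fun_prop)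

theorem ae_flow_mul_flowGrad (i i' j : Fin 2) :
    ∀ᵐ x ∂torusMeasure, flow x j * flowGrad x i i' =
      ∑' p : ℕ × ℕ, vel p.1 j x * grad p.2 i i' x :=
  ae_tsum_mul_tsum (isIntermittent_vel j).integrable (isIntermittent_vel j).summable
    (isIntermittent_grad i i').integrable (isIntermittent_grad i i').summable

theorem integrable_flow_mul_flowGrad (i i' j : Fin 2) :
    Integrable (fun x => flow x j * flowGrad x i i') torusMeasure :=
  (integrable_tsum (integrable_vel_mul_grad i i' j) (summable_vel_mul_grad i i' j)).congr
    ((ae_flow_mul_flowGrad i i' j).mono fun _ h => h.symm)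

theorem integrable_advection (i : Fin 2) :
    Integrable (advection flow flowGrad i) torusMeasure :=
  integrable_finsetSum _ fun j _ => integrable_flow_mul_flowGrad i j j

theorem hasSum_integral_mul_flow_mul_flowGrad {w : Torus2 → ℂ} (hw : Continuous w)
    (i i' j : Fin 2) :
    HasSum (fun p : ℕ × ℕ => ∫ x, w x * ((vel p.1 j x : ℂ) * (grad p.2 i i' x : ℂ))
      ∂torusMeasure) (∫ x, w x * ((flow x j * flowGrad x i i' : ℝ) : ℂ) ∂torusMeasure) := by
  obtain ⟨C, hC⟩ := (HasCompactSupport.of_compactSpace w).exists_bound_of_continuous hw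
  have hasSum_smul := hasSum_integral_smul_of_bounded (integrable_vel_mul_grad i i' j)
    (summable_vel_mul_grad i i' j) hw.aestronglyMeasurable hC
  have integral_eq : ∫ x, w x * ((flow x j * flowGrad x i i' : ℝ) : ℂ) ∂torusMeasure =
      ∫ x, (∑' p : ℕ × ℕ, vel p.1 j x * grad p.2 i i' x) • w x ∂torusMeasure :=
    integral_congr_ae <| (ae_flow_mul_flowGrad i i' j).mono fun x hx => by
      simp only [hx, Complex.real_smul, mul_comm]
  rw [integral_eq]
  simpa only [Complex.real_smul, Complex.ofReal_mul, mul_comm (w _)] using hasSum_smul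

theorem integrable_mul_ofReal {w : Torus2 → ℂ} (hw : Continuous w) {f : Torus2 → ℝ}
    (hf : Integrable f torusMeasure) : Integrable (fun x => w x * (f x : ℂ)) torusMeasure := by
  obtain ⟨C, hC⟩ := (HasCompactSupport.of_compactSpace w).exists_bound_of_continuous hw
  exact hf.ofReal.bdd_mul hw.aestronglyMeasurable (ae_of_all _ hC)

theorem hasSum_integral_mul_advection {w : Torus2 → ℂ} (hw : Continuous w) (i : Fin 2) :
    HasSum (fun p : ℕ × ℕ => ∑ j, ∫ x, w x * ((vel p.1 j x : ℂ) * (grad p.2 i j x : ℂ))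
      ∂torusMeasure) (∫ x, w x * (advection flow flowGrad i x : ℂ) ∂torusMeasure) := by
  have integral_eq : ∫ x, w x * (advection flow flowGrad i x : ℂ) ∂torusMeasure =
      ∑ j, ∫ x, w x * ((flow x j * flowGrad x i j : ℝ) : ℂ) ∂torusMeasure := by
    rw [← integral_finsetSum _ fun j _ =>
      integrable_mul_ofReal hw (integrable_flow_mul_flowGrad i j j)]
    simp only [advection, Complex.ofReal_sum, Finset.mul_sum]
  rw [integral_eq]
  exact hasSum_sum fun j _ => hasSum_integral_mul_flow_mul_flowGrad hw i j j

end Advection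

/-! ### Interactions between blocks -/

/-- The constraints met by the first coordinate of every frequency of the `k`-th block. They alone
keep different blocks from forming a triad. -/
structure IsMode (k : ℕ) (x : ℤ) : Prop where
  dvd : (spacing k : ℤ) ∣ x
  le_abs : 22 * (freqScale k : ℤ) ≤ |x|
  abs_le : |x| ≤ 74 * freqScale k

section Triads

theorem isMode_of_mem {k : ℕ} {α : Freq} (h : α ∈ freqs k) : IsMode k (α 0) :=
  ⟨dvd_of_mem_block h 0, le_abs_of_mem_block h, abs_le_of_mem_block h 0⟩

-- If `q < r`, then `z` is too large to balance `x + y`; if `q = r`, then `spacing r` divides `x`,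
-- which is nonzero but smaller than `spacing r`.
theorem IsMode.add_add_ne_zero {p q r : ℕ} {x y z : ℤ} (hx : IsMode p x) (hy : IsMode q y)
    (hz : IsMode r z) (hpr : p < r) (hqr : q ≤ r) : x + y + z ≠ 0 := by
  intro h
  have freqScale_p_pos : (0 : ℤ) < freqScale p := by exact_mod_cast freqScale_pos p
  have freqScale_p_le : 512 * (freqScale p : ℤ) ≤ spacing r := by
    exact_mod_cast freqScale_le_spacing hpr
  rcases hqr.lt_or_eq with hqr | rfl
  · have freqScale_q_le : 512 * (freqScale q : ℤ) ≤ spacing r := by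
      exact_mod_cast freqScale_le_spacing hqr
    have spacing_le : (spacing r : ℤ) ≤ freqScale r := by
      exact_mod_cast Nat.le_mul_of_pos_right _ (scale_pos r)
    have abs_z : |z| = |x + y| := by rw [← abs_neg, eq_neg_of_add_eq_zero_left h]
    linarith [hz.le_abs, abs_add_le x y, hx.abs_le, hy.abs_le]
  · have dvd_x : (spacing q : ℤ) ∣ x := by
      rw [add_assoc] at h
      rw [eq_neg_of_add_eq_zero_left h, dvd_neg]
      exact dvd_add hy.dvd hz.dvd
    have x_eq_zero : x = 0 := Int.eq_zero_of_abs_lt_dvd dvd_x (by linarith [hx.abs_le])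
    have le_zero := hx.le_abs
    rw [x_eq_zero, abs_zero] at le_zero
    linarith

theorem eq_of_add_mem_freqs {j l m : ℕ} {b c : Freq} (hb : b ∈ freqs l) (hc : c ∈ freqs m)
    (hbc : b + c ∈ freqs j) : l = j ∧ m = j := by
  have mode_b := isMode_of_mem hb
  have mode_c := isMode_of_mem hc
  have mode_sum := isMode_of_mem (neg_mem_freqs hbc)
  have sum_eq_zero : b 0 + c 0 + (-(b + c)) 0 = 0 := add_neg_cancel (b 0 + c 0)
  by_contra hne
  have strict_max : (l < j ∧ m ≤ j) ∨ (m < j ∧ l ≤ j) ∨ (l < m ∧ j ≤ m) ∨ (j < m ∧ l ≤ m) ∨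
      (m < l ∧ j ≤ l) ∨ (j < l ∧ m ≤ l) := by omega
  rcases strict_max with h | h | h | h | h | h
  · exact mode_b.add_add_ne_zero mode_c mode_sum h.1 h.2 (by linarith)
  · exact mode_c.add_add_ne_zero mode_b mode_sum h.1 h.2 (by linarith)
  · exact mode_b.add_add_ne_zero mode_sum mode_c h.1 h.2 (by linarith)
  · exact mode_sum.add_add_ne_zero mode_b mode_c h.1 h.2 (by linarith)
  · exact mode_c.add_add_ne_zero mode_sum mode_b h.1 h.2 (by linarith)
  · exact mode_sum.add_add_ne_zero mode_c mode_b h.1 h.2 (by linarith)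

theorem sum_integral_trigPoly_mul_advection {κ : Freq → ℝ} (hκ : ∀ α, κ (-α) = κ α) (j : ℕ) :
    ∑ i, ∫ x, trigPoly (freqs j) (fun α => κ α * velCoeff (psi j) i α) x *
      (advection flow flowGrad i x : ℂ) ∂torusMeasure =
    ((∑ b ∈ freqs j, ∑ c ∈ freqs j, interaction κ (psi j) (psi j) (psi j) b c : ℝ) : ℂ) := by
  have hasSum_blocks := hasSum_sum fun i (_ : i ∈ Finset.univ) => hasSum_integral_mul_advection
    (continuous_trigPoly (freqs j) (fun α => κ α * velCoeff (psi j) i α)) i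
  simp_rw [ofReal_vel, ofReal_grad] at hasSum_blocks
  have block_eq : ∀ p : ℕ × ℕ, ∑ i, ∑ i', ∫ x,
      trigPoly (freqs j) (fun α => κ α * velCoeff (psi j) i α) x *
        (trigPoly (freqs p.1) (velCoeff (psi p.1) i') x *
          trigPoly (freqs p.2) (gradCoeff (psi p.2) i i') x) ∂torusMeasure =
      ((∑ b ∈ freqs p.1, ∑ c ∈ freqs p.2,
        interaction κ (psi j) (psi p.1) (psi p.2) b c : ℝ) : ℂ) := fun p =>
    sum_integral_trilinear _ _ _ _ (fun _ => psi_eq_zero) (psi_neg j) hκ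
  simp_rw [block_eq] at hasSum_blocks
  refine hasSum_blocks.unique (hasSum_single (j, j) ?_)
  rintro ⟨l, m⟩ hne
  rw [Complex.ofReal_eq_zero]
  refine Finset.sum_eq_zero fun b hb => Finset.sum_eq_zero fun c hc => ?_
  have psi_sum_eq_zero : psi j (b + c) = 0 := psi_eq_zero fun hbc =>
    hne (Prod.ext (eq_of_add_mem_freqs hb hc hbc).1 (eq_of_add_mem_freqs hb hc hbc).2)
  simp only [interaction, psi_sum_eq_zero, zero_mul, mul_zero]

end Triads

/-! ### The flux through the critical scales -/

section Truncation

variable {χ : Plane → ℝ}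

theorem symbol_neg (hχ : IsRoughCutoff χ) (q : ℕ) (α : Freq) :
    symbol χ q (-α) = symbol χ q α := by
  have freq_neg : freq (-α) = -freq α := by ext i; simp [freq]
  simp only [symbol, freq_neg, smul_neg, hχ.even]

theorem symbol_eq_one (hχ : IsRoughCutoff χ) {q : ℕ} {α : Freq} (h : ‖freq α‖ ≤ 2 ^ q / 2) :
    symbol χ q α = 1 := by
  refine hχ.eq_one _ ?_
  rw [norm_inv_two_pow_smul_freq, div_le_iff₀ (by positivity)]
  linarith

theorem symbol_eq_zero (hχ : IsRoughCutoff χ) {q : ℕ} {α : Freq} (h : 2 ^ q < ‖freq α‖) :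
    symbol χ q α = 0 := by
  refine hχ.eq_zero _ ?_
  rwa [norm_inv_two_pow_smul_freq, lt_div_iff₀ (by positivity), one_mul]

theorem symbol_eq_zero_of_notMem_box (hχ : IsRoughCutoff χ) {q : ℕ} {α : Freq}
    (h : α ∉ box (2 ^ q)) : symbol χ q α = 0 := by
  refine symbol_eq_zero hχ ?_
  contrapose! h
  refine mem_box.2 fun i => ?_
  exact_mod_cast (abs_le_norm_freq α i).trans h

theorem lpTruncation_eq_trigPoly (hχ : IsRoughCutoff χ) (q : ℕ) (f : Torus2 → ℝ) :
    lpTruncation χ q f = trigPoly (box (2 ^ q)) fun α =>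
      (symbol χ q α : ℂ) * mFourierCoeff (fun y => (f y : ℂ)) α :=
  dyadicMultiplier_eq_trigPoly fun _ h => .inl (symbol_eq_zero_of_notMem_box hχ h)

theorem continuous_lpTruncation (hχ : IsRoughCutoff χ) (q : ℕ) (f : Torus2 → ℝ) :
    Continuous (lpTruncation χ q f) := by
  rw [lpTruncation_eq_trigPoly hχ]
  fun_prop

theorem mFourierCoeff_lpTruncation (hχ : IsRoughCutoff χ) (q : ℕ) (f : Torus2 → ℝ) (α : Freq) :
    mFourierCoeff (lpTruncation χ q f) α =
      symbol χ q α * mFourierCoeff (fun y => (f y : ℂ)) α := by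
  rw [lpTruncation_eq_trigPoly hχ, mFourierCoeff]
  refine (integral_mFourier_mul_trigPoly _ _ _).trans ?_
  rw [neg_neg, ite_eq_left_iff]
  intro hα
  rw [symbol_eq_zero_of_notMem_box hχ hα, Complex.ofReal_zero, zero_mul]

theorem integral_trigPoly_mul (s : Finset Freq) (c : Freq → ℂ) {f : Torus2 → ℂ}
    (hf : Integrable f torusMeasure) :
    ∫ x, trigPoly s c x * f x ∂torusMeasure = ∑ α ∈ s, c α * mFourierCoeff f (-α) := by
  have integrable_mode : ∀ α, Integrable (fun x => mFourier α x * f x) torusMeasure := fun α =>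
    hf.bdd_mul (by fun_prop) (ae_of_all _ fun x => (norm_mFourier_apply α x).le)
  simp_rw [trigPoly, Finset.sum_mul, mul_assoc]
  rw [integral_finsetSum _ fun α _ => (integrable_mode α).const_mul (c α)]
  simp_rw [integral_const_mul, mFourierCoeff, neg_neg, smul_eq_mul]
  rfl

theorem integral_trigPoly_mul_lpTruncation (hχ : IsRoughCutoff χ) (q : ℕ) (s : Finset Freq)
    (c : Freq → ℂ) {f : Torus2 → ℝ} (hf : Integrable f torusMeasure) :
    ∫ x, trigPoly s c x * lpTruncation χ q f x ∂torusMeasure =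
      ∫ x, trigPoly s (fun α => symbol χ q α * c α) x * (f x : ℂ) ∂torusMeasure := by
  rw [integral_trigPoly_mul _ _ (integrable_of_continuous (continuous_lpTruncation hχ q f)),
    integral_trigPoly_mul _ _ (f := fun x => (f x : ℂ)) hf.ofReal]
  refine Finset.sum_congr rfl fun α _ => ?_
  rw [mFourierCoeff_lpTruncation hχ, symbol_neg hχ]
  ring

end Truncation

section CriticalScale

variable {χ : Plane → ℝ} {q k : ℕ}

theorem symbol_eq_one_of_lt (hχ : IsRoughCutoff χ) (hq : (2 : ℝ) ^ q = 64 * freqScale k) {j : ℕ}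
    (hj : j < k) {α : Freq} (hα : α ∈ freqs j) : symbol χ q α = 1 := by
  have freqScale_le : (512 : ℝ) * freqScale j ≤ freqScale k := by
    exact_mod_cast freqScale_le_freqScale hj
  refine symbol_eq_one hχ ?_
  rw [hq]
  linarith [norm_freq_le_of_mem hα, Nat.cast_nonneg (α := ℝ) (freqScale k)]

theorem symbol_eq_zero_of_lt (hχ : IsRoughCutoff χ) (hq : (2 : ℝ) ^ q = 64 * freqScale k) {l : ℕ}
    (hl : k < l) {α : Freq} (hα : α ∈ freqs l) : symbol χ q α = 0 := by
  have freqScale_le : (512 : ℝ) * freqScale k ≤ freqScale l := by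
    exact_mod_cast freqScale_le_freqScale hl
  have freqScale_pos : (0 : ℝ) < freqScale k := by exact_mod_cast freqScale_pos k
  refine symbol_eq_zero hχ ?_
  rw [hq]
  linarith [le_norm_freq_of_mem hα]

theorem norm_freq_node_le {M s : ℕ} {z β : Freq} (hz : z ∈ innerCenters) (hβ : β ∈ box (2 * s)) :
    ‖freq (node M s z β)‖ ≤ 32 * (M * s) := by
  have hβ0 : |(β 0 : ℝ)| ≤ 2 * s := by exact_mod_cast mem_box.1 hβ 0
  have hβ1 : |(β 1 : ℝ)| ≤ 2 * s := by exact_mod_cast mem_box.1 hβ 1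
  have abs_z0 : ∀ z ∈ innerCenters, |z 0| = 3 := by decide
  have z1_eq : ∀ z ∈ innerCenters, z 1 = 0 := by decide
  have abs_z0_real : |(z 0 : ℝ)| = 3 := by exact_mod_cast abs_z0 z hz
  have sum_le : |8 * (s : ℝ) * z 0 + β 0| + |8 * (s : ℝ) * z 1 + β 1| ≤ 32 * s := by
    rw [z1_eq z hz, Int.cast_zero, mul_zero, zero_add]
    have abs_add := abs_add_le (8 * (s : ℝ) * z 0) (β 0)
    rw [abs_mul, abs_z0_real, abs_of_nonneg (by positivity : (0 : ℝ) ≤ 8 * s)] at abs_add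
    linarith [Nat.cast_nonneg (α := ℝ) s]
  refine (norm_freq_le _).trans ?_
  simp only [node]
  push_cast
  rw [abs_mul, abs_mul, Nat.abs_cast, ← mul_add, mul_left_comm]
  gcongr

theorem lt_norm_freq_node {M s : ℕ} (hM : 0 < M) (hs : 0 < s) {z β : Freq} (hz : z ∈ centers)
    (hz' : z ∉ innerCenters) (hβ : β ∈ box (2 * s)) : 64 * (M * s) < ‖freq (node M s z β)‖ := by
  have hβ1 : |(β 1 : ℝ)| ≤ 2 * s := by exact_mod_cast mem_box.1 hβ 1
  have abs_z1 : ∀ z ∈ centers, z ∉ innerCenters → |z 1| = 9 := by decide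
  have abs_z1_real : |(z 1 : ℝ)| = 9 := by exact_mod_cast abs_z1 z hz hz'
  have s_pos : (0 : ℝ) < s := by exact_mod_cast hs
  have lt_abs : 64 * (s : ℝ) < |8 * (s : ℝ) * z 1 + β 1| := by
    have abs_sub := abs_sub_abs_le_abs_add (8 * (s : ℝ) * z 1) (β 1)
    rw [abs_mul, abs_z1_real, abs_of_nonneg (by positivity : (0 : ℝ) ≤ 8 * s)] at abs_sub
    linarith
  refine lt_of_lt_of_le ?_ (abs_le_norm_freq _ 1)
  simp only [node]
  push_cast
  rw [abs_mul, Nat.abs_cast, mul_left_comm]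
  gcongr

theorem keepsInner_symbol_sq (hχ : IsRoughCutoff χ) (hq : (2 : ℝ) ^ q = 64 * freqScale k) :
    KeepsInner (fun α => symbol χ q α ^ 2) (spacing k) (scale k) where
  eq_one z hz β hβ := by
    have norm_le := norm_freq_node_le (M := spacing k) hz hβ
    rw [symbol_eq_one hχ (by rw [hq, freqScale]; push_cast; linarith), one_pow]
  eq_zero z hz hz' β hβ := by
    have lt_norm := lt_norm_freq_node (spacing_pos k) (scale_pos k) hz hz' hβ
    rw [symbol_eq_zero hχ (by rw [hq, freqScale]; push_cast; exact lt_norm), zero_pow two_ne_zero]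

theorem lpTruncation_flow (hχ : IsRoughCutoff χ) (hq : (2 : ℝ) ^ q = 64 * freqScale k)
    (i : Fin 2) :
    lpTruncation χ q (fun x => flow x i) = fun x => ∑ j ∈ Finset.range (k + 1),
      trigPoly (freqs j) (fun α => (symbol χ q α : ℂ) * velCoeff (psi j) i α) x :=
  dyadicMultiplier_flow (fun _ hl _ hα => symbol_eq_zero_of_lt hχ hq
    (by simpa only [Finset.mem_range, not_lt, Nat.succ_le_iff] using hl) hα) i

theorem integral_lpTruncation_flow_mul (hχ : IsRoughCutoff χ)
    (hq : (2 : ℝ) ^ q = 64 * freqScale k) (i : Fin 2) {f : Torus2 → ℝ}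
    (hf : Integrable f torusMeasure) :
    ∫ x, lpTruncation χ q (fun y => flow y i) x * lpTruncation χ q f x ∂torusMeasure =
      ∑ j ∈ Finset.range (k + 1), ∫ x, trigPoly (freqs j)
        (fun α => ((symbol χ q α ^ 2 : ℝ) : ℂ) * velCoeff (psi j) i α) x * (f x : ℂ)
          ∂torusMeasure := by
  simp_rw [lpTruncation_flow hχ hq, Finset.sum_mul]
  rw [integral_finsetSum _ fun j _ => integrable_of_continuous
    ((continuous_trigPoly _ _).fun_mul (continuous_lpTruncation hχ q f))]
  simp_rw [integral_trigPoly_mul_lpTruncation hχ q _ _ hf, ← mul_assoc, ← Complex.ofReal_mul,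
    ← sq]

-- The truncation keeps the blocks before the `k`-th one unchanged, and these have no flux.
theorem energyFlux_flow (hχ : IsRoughCutoff χ) (hq : (2 : ℝ) ^ q = 64 * freqScale k) :
    energyFlux χ q flow flowGrad = ∑ b ∈ freqs k, ∑ c ∈ freqs k,
      interaction (fun α => symbol χ q α ^ 2) (psi k) (psi k) (psi k) b c := by
  rw [energyFlux, integral_finsetSum _ fun i _ => integrable_of_continuous
    ((continuous_lpTruncation hχ q _).fun_mul (continuous_lpTruncation hχ q _))]
  simp_rw [integral_lpTruncation_flow_mul hχ hq _ (integrable_advection _)]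
  rw [Finset.sum_comm]
  simp_rw [sum_integral_trigPoly_mul_advection (κ := fun α => symbol χ q α ^ 2)
    fun α => by rw [symbol_neg hχ]]
  rw [← Complex.ofReal_sum, Complex.ofReal_re, Finset.sum_range_succ, add_eq_right]
  refine Finset.sum_eq_zero fun j hj => sum_interaction_eq_zero (fun _ => psi_eq_zero)
    (fun _ => neg_mem_freqs) (psi_neg j) fun α hα => ?_
  rw [symbol_eq_one_of_lt hχ hq (Finset.mem_range.1 hj) hα, one_pow]

theorem four_dvd_scale (k : ℕ) : 4 ∣ scale k := by
  have two_dvd_scaleRoot : 2 ∣ scaleRoot k := dvd_pow (two_dvd_spacingRoot k) (by omega)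
  exact (pow_dvd_pow 2 (by norm_num : 2 ≤ 3)).trans (pow_dvd_pow_of_dvd two_dvd_scaleRoot 3)

theorem pi_div_sixteen_le_energyFlux (hχ : IsRoughCutoff χ)
    (hq : (2 : ℝ) ^ q = 64 * freqScale k) : Real.pi / 16 ≤ energyFlux χ q flow flowGrad := by
  obtain ⟨τ, hτ⟩ := four_dvd_scale k
  have τ_pos : 0 < τ := by have := scale_pos k; omega
  have le_flux := le_sum_interaction (amplitude_nonneg k) (spacing_pos k) τ_pos
    (hτ ▸ keepsInner_symbol_sq hχ hq)
  rw [← hτ] at le_flux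
  rw [energyFlux_flow hχ hq]
  refine le_trans (le_of_eq ?_) le_flux
  have hH := (cast_spacingRoot_pos k).ne'
  have hG := (cast_scaleRoot_pos k).ne'
  have four_mul_τ : 4 * (τ : ℝ) = (scaleRoot k : ℝ) ^ 3 := by exact_mod_cast hτ.symm
  have two_mul_τ : 2 * (τ : ℝ) = (scaleRoot k : ℝ) ^ 3 / 2 := by linarith
  rw [two_mul_τ, four_mul_τ, amplitude, spacing]
  push_cast
  field_simp
  norm_num

theorem exists_two_pow_eq (k : ℕ) : ∃ q, k ≤ q ∧ (2 : ℝ) ^ q = 64 * freqScale k := by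
  obtain ⟨e, he⟩ := exists_spacingRoot_eq_two_pow k
  have two_pow_eq : 2 ^ (6 + (e * 3 + e * (k + 3) * 3)) = 64 * freqScale k := by
    rw [freqScale, spacing, scale, scaleRoot, he]
    simp only [pow_add, pow_mul]
    norm_num
  refine ⟨_, (Nat.pow_le_pow_iff_right one_lt_two).1 ?_, by exact_mod_cast two_pow_eq⟩
  rw [two_pow_eq]
  calc 2 ^ k ≤ 8 ^ (k + 1) := by gcongr <;> omega
    _ ≤ spacingRoot k := eight_pow_le_spacingRoot k
    _ ≤ spacing k := Nat.le_self_pow (by norm_num) _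
    _ ≤ freqScale k := Nat.le_mul_of_pos_right _ (scale_pos k)
    _ ≤ 64 * freqScale k := by omega

theorem limsup_energyFlux_pos (hχ : IsRoughCutoff χ) :
    0 < limsup (fun q : ℕ => (energyFlux χ q flow flowGrad : EReal)) atTop := by
  have bound_pos : (0 : EReal) < ((Real.pi / 16 : ℝ) : EReal) :=
    EReal.coe_pos.2 (by positivity)
  refine bound_pos.trans_le (le_limsup_of_frequently_le' (frequently_atTop.2 fun n => ?_))
  obtain ⟨q, hnq, hq⟩ := exists_two_pow_eq n
  exact ⟨q, hnq, EReal.coe_le_coe_iff.2 (pi_div_sixteen_le_energyFlux hχ hq)⟩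

end CriticalScale

end IntermittentFlow

end

theorem theorem3_general :
    ∃ (u : Torus2 → Plane) (G : Torus2 → Matrix (Fin 2) (Fin 2) ℝ),
      IsDivergenceFree u ∧
      (∀ p : ℝ≥0∞, 1 ≤ p → p < 3 / 2 → MemSobolevOne p u) ∧
      HasWeakGradient u G ∧
      (∀ i, Integrable (advection u G i) torusMeasure) ∧
      ∀ χ, IntermittentFlow.IsRoughCutoff χ → MemBesovTop χ (1 / 3) 3 u ∧
        0 < limsup (fun q : ℕ => (energyFlux χ q u G : EReal)) atTop :=
  ⟨IntermittentFlow.flow, IntermittentFlow.flowGrad, IntermittentFlow.isDivergenceFree_flow,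
    fun _ => IntermittentFlow.memSobolevOne_flow, IntermittentFlow.hasWeakGradient_flow,
    IntermittentFlow.integrable_advection, fun _ hχ =>
      ⟨IntermittentFlow.memBesovTop_flow hχ, IntermittentFlow.limsup_energyFlux_pos hχ⟩⟩

theorem theorem3 (χ : Plane → ℝ) (hχ : IsCutoff χ) :
    ∃ (u : Torus2 → Plane) (G : Torus2 → Matrix (Fin 2) (Fin 2) ℝ),
      IsDivergenceFree u ∧
      MemBesovTop χ (1 / 3) 3 u ∧
      (∀ p : ℝ≥0∞, 1 ≤ p → p < 3 / 2 → MemSobolevOne p u) ∧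
      HasWeakGradient u G ∧
      (∀ i, Integrable (advection u G i) torusMeasure) ∧
      limsup (fun q : ℕ => (energyFlux χ q u G : EReal)) atTop ≠ 0 :=
  let ⟨u, G, hdiv, hsobolev, hgrad, hadv, h⟩ := theorem3_general
  let ⟨hbesov, hflux⟩ := h χ (IntermittentFlow.IsCutoff.isRoughCutoff hχ)
  ⟨u, G, hdiv, hbesov, hsobolev, hgrad, hadv, hflux.ne'⟩
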